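/- Work in Euclidean space $\mathbb{R}^n$ with scalar product $\langle\cdot,\cdot\rangle$. Symmetric tensors of rank $p$ are the symmetric $p$-linear maps $(\mathbb{R}^n)^p\to\mathbb{R}$, products and powers are symmetric tensor products and powers (with $T^0=1$), $Q(x,y)=\langle x,y\rangle$ is the metric tensor, and $Q(L)(x,y)=\langle p_Lx,p_Ly\rangle$ for a linear subspace $L$ with orthogonal projection $p_L$. For linear subspaces $L,L'$, extend an orthonormal basis of $L\cap L'$ to an orthonormal basis of $L$ and to one of $L'$; the subspace determinant $[L,L']$ is the volume of the parallelepiped spanned by all these vectors. Let $G(n,d)$ be the Grassmannian of $d$-dimensional linear subspaces of $\mathbb{R}^n$ and $\nu_d$ its rotation invariant (Haar) probability measure. Let $0\le j\le k\le n$ and $m,l\ge 0$ be integers and let $F\in G(n,k)$. Then the function $L\mapsto [F,L]^2\,Q(L)^m\,Q(F\cap L)^l$ is integrable on $G(n,n-k+j)$ and $$ \begin{aligned} \int_{G(n,n-k+j)} [F,L]^2\, Q(L)^m\, Q(F\cap L)^l\,\nu_{n-k+j}(dL) ={}& \frac{(n-k+j)!\,k!}{n!\,j!}\, \frac{\Gamma(\frac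 n2+1)\,\Gamma(\frac j2+l)\,\Gamma(\frac k2)} {\Gamma(\frac n2+m+1)\,\Gamma(\frac j2)\,\Gamma(\frac{k-j}2)\,\Gamma(\frac{n-k+j}2+1)}\\ &\times\sum_{i=0}^m\binom mi\frac{(l+i-2)!}{(l-2)!}\, \frac{\Gamma(\frac{k-j}2+i)\,\Gamma(\frac{n-k+j}2+m-i+1)}{\Gamma(\frac k2+l+i)}\; Q^{m-i}\,Q(F)^{l+i}. \end{aligned} $$ Here the quotients $\frac{(l+i-2)!}{(l-2)!}=\frac{\Gamma(l-1+i)}{\Gamma(l-1)}$, $\frac{\Gamma(\frac j2+l)}{\Gamma(\frac j2)}$, $\frac{\Gamma(\frac{k-j}2+i)}{\Gamma(\frac{k-j}2)}$ and $\frac{\Gamma(\frac k2+l+i)}{\Gamma(\frac k2)}$ are read by continuous extension at the poles of $\Gamma$, that is, $\frac{\Gamma(a+p)}{\Gamma(a)}=a(a+1)\cdots(a+p-1)$ for $p\in\mathbb{N}_0$. In particular $\frac{(l+i-2)!}{(l-2)!}$ equals $1,-1,0,0,\ldots$ for $i=0,1,2,3,\ldots$ if $l=0$, and $1,0,0,\ldots$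 if $l=1$. In the case $k=0$, a summand with $l+i>0$ is read as $0$ (there $Q(F)=0$). -/

import Mathlib

open MeasureTheory Filter Topology TopologicalSpace

/-- The `n`-dimensional Euclidean space `ℝⁿ`. -/
abbrev Eucl (n : ℕ) : Type := EuclideanSpace ℝ (Fin n)

/-! ### Symmetric tensors -/

/-- The symmetric `p`-linear maps `(ℝⁿ)^p → ℝ`, as a linear subspace of all (continuous)
`p`-linear maps. -/
noncomputable def symTensorSubmodule (n p : ℕ) :
    Submodule ℝ (ContinuousMultilinearMap ℝ (fun _ : Fin p => Eucl n) ℝ) where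
  carrier := {T | ∀ (σ : Equiv.Perm (Fin p)) (v : Fin p → Eucl n), T (v ∘ σ) = T v}
  add_mem' {S T} hS hT σ v := by simp [hS σ v, hT σ v]
  zero_mem' σ v := by simp
  smul_mem' c T hT σ v := by simp [hT σ v]

theorem symTensorSubmodule_isClosed (n p : ℕ) : IsClosed
    (symTensorSubmodule n p : Set (ContinuousMultilinearMap ℝ (fun _ : Fin p => Eucl n) ℝ)) := by
  have h : (symTensorSubmodule n p :
      Set (ContinuousMultilinearMap ℝ (fun _ : Fin p => Eucl n) ℝ)) =
      ⋂ (σ : Equiv.Perm (Fin p)), ⋂ (v : Fin p → Eucl n), {T | T (v ∘ σ) = T v} := by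
    ext T
    simp [symTensorSubmodule]
  rw [h]
  refine isClosed_iInter fun σ => isClosed_iInter fun v => isClosed_eq ?_ ?_ <;> fun_prop

/-- The space `𝕋^p` of symmetric tensors of rank `p` over `ℝⁿ`: symmetric `p`-linear maps
`(ℝⁿ)^p → ℝ`, with the operator norm of multilinear maps. -/
def SymTensor (n p : ℕ) : Type := ↥(symTensorSubmodule n p)

noncomputable instance SymTensor.instNormedAddCommGroup (n p : ℕ) :
    NormedAddCommGroup (SymTensor n p) :=
  inferInstanceAs (NormedAddCommGroup ↥(symTensorSubmodule n p))

noncomputable instance SymTensor.instNormedSpace (n p : ℕ) : NormedSpace ℝ (SymTensor n p) :=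
  inferInstanceAs (NormedSpace ℝ ↥(symTensorSubmodule n p))

instance SymTensor.instCompleteSpace (n p : ℕ) : CompleteSpace (SymTensor n p) :=
  (symTensorSubmodule_isClosed n p).completeSpace_coe

/-- The multilinear map `(ℝⁿ)^p → ℝ` underlying a symmetric tensor. -/
def SymTensor.toMap {n p : ℕ} (T : SymTensor n p) :
    ContinuousMultilinearMap ℝ (fun _ : Fin p => Eucl n) ℝ := T.1

/-- The (unsymmetrized) tensor product
`(S ⊗ T)(x₁, …, x_{p+q}) = S(x₁, …, x_p) T(x_{p+1}, …, x_{p+q})`. -/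
noncomputable def tensorMul {n p q : ℕ}
    (S : ContinuousMultilinearMap ℝ (fun _ : Fin p => Eucl n) ℝ)
    (T : ContinuousMultilinearMap ℝ (fun _ : Fin q => Eucl n) ℝ) :
    ContinuousMultilinearMap ℝ (fun _ : Fin (p + q) => Eucl n) ℝ :=
  (ContinuousMultilinearMap.uncurrySum (S.smulRight T)).domDomCongr finSumFinEquiv

theorem tensorMul_apply {n p q : ℕ}
    (S : ContinuousMultilinearMap ℝ (fun _ : Fin p => Eucl n) ℝ)
    (T : ContinuousMultilinearMap ℝ (fun _ : Fin q => Eucl n) ℝ) (v : Fin (p + q) → Eucl n) :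
    tensorMul S T v =
      S (fun i => v (Fin.castAdd q i)) * T (fun i => v (Fin.natAdd p i)) := by
  simp [tensorMul, Function.comp_def]

/-- The symmetric tensor product `S T` of symmetric tensors,
`(S T)(x₁, …, x_r) = (1 / r!) ∑_σ (S ⊗ T)(x_{σ(1)}, …, x_{σ(r)})` with `r = p + q`. -/
noncomputable def SymTensor.mul {n p q : ℕ} (S : SymTensor n p) (T : SymTensor n q) :
    SymTensor n (p + q) :=
  ⟨((p + q).factorial : ℝ)⁻¹ •
      ∑ σ : Equiv.Perm (Fin (p + q)),
        (tensorMul S.toMap T.toMap).domDomCongr σ, by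
    intro τ v
    simp only [smul_apply, sum_apply,
      ContinuousMultilinearMap.domDomCongr_apply]
    congr 1
    exact Fintype.sum_equiv (Equiv.mulLeft τ) _ _ (fun σ => rfl)⟩

/-- The scalar `1 ∈ 𝕋^0 = ℝ`. -/
noncomputable def SymTensor.one (n : ℕ) : SymTensor n 0 :=
  ⟨ContinuousMultilinearMap.constOfIsEmpty ℝ (fun _ : Fin 0 => Eucl n) 1, fun σ v => by simp⟩

/-- The `q`-fold symmetric tensor power `T^q`, with `T^0 = 1`. -/
noncomputable def SymTensor.pow {n p : ℕ} (T : SymTensor n p) : (q : ℕ) → SymTensor n (p * q)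
  | 0 => SymTensor.one n
  | q + 1 => SymTensor.mul (SymTensor.pow T q) T

/-- Transport of a tensor along an equality of ranks. -/
def SymTensor.cast {n p q : ℕ} (h : p = q) (T : SymTensor n p) : SymTensor n q := h ▸ T

/-- The rank two tensor `(x, y) ↦ ⟨A x, A y⟩`. -/
noncomputable def SymTensor.ofMap {n : ℕ} (A : Eucl n →L[ℝ] Eucl n) : SymTensor n 2 :=
  ⟨{ toFun := fun v => inner ℝ (A (v 0)) (A (v 1))
     map_update_add' := by
       intro inst v i x y
       obtain rfl : inst = instDecidableEqFin 2 := Subsingleton.elim _ _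
       fin_cases i <;> simp [inner_add_left, inner_add_right]
     map_update_smul' := by
       intro inst v i c x
       obtain rfl : inst = instDecidableEqFin 2 := Subsingleton.elim _ _
       fin_cases i <;> simp [inner_smul_left, inner_smul_right]
     cont := by fun_prop }, by
    intro σ v
    have h : σ = 1 ∨ σ = Equiv.swap 0 1 := by
      revert σ
      decide
    rcases h with rfl | rfl
    · rfl
    · exact real_inner_comm (A (v 0)) (A (v 1))⟩

theorem SymTensor.ofMap_apply {n : ℕ} (A : Eucl n →L[ℝ] Eucl n) (v : Fin 2 → Eucl n) :
    (SymTensor.ofMap A).toMap v = inner ℝ (A (v 0)) (A (v 1)) := rfl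

/-- The metric tensor `Q(x, y) = ⟨x, y⟩`. -/
noncomputable def metricTensor (n : ℕ) : SymTensor n 2 :=
  SymTensor.ofMap (ContinuousLinearMap.id ℝ (Eucl n))

/-- The metric tensor `Q(L)(x, y) = ⟨p_L x, p_L y⟩` of a linear subspace `L`, where `p_L` is the
orthogonal projection to `L`. -/
noncomputable def metricTensorOf {n : ℕ} (L : Submodule ℝ (Eucl n)) : SymTensor n 2 :=
  SymTensor.ofMap L.starProjection

/-! ### The subspace determinant -/

/-- The `r`-dimensional volume of the parallelepiped spanned by `r` vectors. -/
noncomputable def parallelepipedVolume {n : ℕ} {ι : Type} [Fintype ι] [DecidableEq ι]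
    (v : ι → Eucl n) : ℝ :=
  Real.sqrt (Matrix.gram ℝ v).det

/-- The subspace determinant `[L, L']`: an orthonormal basis of `L ∩ L'` is extended to an
orthonormal basis of `L` (by one of `L ∩ (L ∩ L')ᗮ`) and to one of `L'` (by one of
`L' ∩ (L ∩ L')ᗮ`); `[L, L']` is the volume of the parallelepiped spanned by all these vectors.
(The value does not depend on the choice of the orthonormal bases.) -/
noncomputable def subspaceDet {n : ℕ} (L L' : Submodule ℝ (Eucl n)) : ℝ :=
  parallelepipedVolume
    (Sum.elim (fun i => (stdOrthonormalBasis ℝ ↥(L ⊓ L') i : Eucl n))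
      (Sum.elim (fun i => (stdOrthonormalBasis ℝ ↥(L ⊓ (L ⊓ L')ᗮ) i : Eucl n))
        (fun i => (stdOrthonormalBasis ℝ ↥(L' ⊓ (L ⊓ L')ᗮ) i : Eucl n))))

/-! ### The Grassmannian and its invariant probability measure -/

/-- The Grassmannian `G(n, d)` of `d`-dimensional linear subspaces of `ℝⁿ`. -/
def Grassmannian (n d : ℕ) : Type := {L : Submodule ℝ (Eucl n) // Module.finrank ℝ L = d}

/-- The linear subspace underlying an element of the Grassmannian. -/
def Grassmannian.space {n d : ℕ} (L : Grassmannian n d) : Submodule ℝ (Eucl n) := L.1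

/-- The usual topology of the Grassmannian, induced by `L ↦ p_L`. -/
noncomputable instance Grassmannian.instTopologicalSpace (n d : ℕ) :
    TopologicalSpace (Grassmannian n d) :=
  TopologicalSpace.induced (fun L => L.space.starProjection) inferInstance

/-- The Borel `σ`-algebra of the Grassmannian. -/
noncomputable instance Grassmannian.instMeasurableSpace (n d : ℕ) :
    MeasurableSpace (Grassmannian n d) := borel _

instance Grassmannian.instBorelSpace (n d : ℕ) : BorelSpace (Grassmannian n d) := ⟨rfl⟩

/-- The orthogonal group `O(n)` of orthogonal real `n × n` matrices, with the topology induced from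
the space of matrices. -/
abbrev OrthGroup (n : ℕ) : Type := Matrix.orthogonalGroup (Fin n) ℝ

/-- The Borel `σ`-algebra of `O(n)`. -/
instance OrthGroup.instMeasurableSpace (n : ℕ) : MeasurableSpace (OrthGroup n) := borel _

instance OrthGroup.instBorelSpace (n : ℕ) : BorelSpace (OrthGroup n) := ⟨rfl⟩

instance OrthGroup.instCompactSpace (n : ℕ) : CompactSpace (OrthGroup n) := by
  apply isCompact_iff_compactSpace.1
  have hK : IsCompact (Set.univ.pi fun _ : Fin n => Set.univ.pi fun _ : Fin n =>
      Set.Icc (-1 : ℝ) 1) :=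
    isCompact_univ_pi fun _ => isCompact_univ_pi fun _ => isCompact_Icc
  refine hK.of_isClosed_subset (isClosed_unitary (R := Matrix (Fin n) (Fin n) ℝ)) ?_
  intro A hA i _ j _
  have h := entry_norm_bound_of_unitary hA i j
  rw [Real.norm_eq_abs] at h
  exact abs_le.1 h

/-- The Haar probability measure on `O(n)`. -/
noncomputable def OrthGroup.haar (n : ℕ) : Measure (OrthGroup n) := Measure.haarMeasure ⊤

instance OrthGroup.instIsProbabilityMeasure (n : ℕ) : IsProbabilityMeasure (OrthGroup.haar n) :=
  ⟨by simpa [OrthGroup.haar] using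
    Measure.haarMeasure_self (K₀ := (⊤ : PositiveCompacts (OrthGroup n)))⟩

theorem OrthGroup.injective {n : ℕ} (A : OrthGroup n) :
    Function.Injective (Matrix.toEuclideanLin A.1) := by
  intro x y h
  have h2 : (A.1).transpose * A.1 = 1 := (Matrix.mem_orthogonalGroup_iff' (Fin n) ℝ).1 A.2
  have h3 := congrArg (fun z => Matrix.mulVec (A.1).transpose z.ofLp) h
  have h4 : x.ofLp = y.ofLp := by simpa [Matrix.mulVec_mulVec, h2] using h3
  exact (WithLp.ofLp_injective 2) h4

/-- The image `A L` of a subspace `L` under `A ∈ O(n)`. -/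
noncomputable def OrthGroup.act {n d : ℕ} (A : OrthGroup n) (L : Grassmannian n d) :
    Grassmannian n d :=
  ⟨L.space.map (Matrix.toEuclideanLin A.1),
    (L.space.equivMapOfInjective _ A.injective).finrank_eq.symm.trans L.2⟩

/-- The coordinate subspace spanned by the first `d` standard basis vectors of `ℝⁿ`. -/
noncomputable def Grassmannian.coord (n d : ℕ) (h : d ≤ n) : Grassmannian n d :=
  ⟨Submodule.span ℝ (Set.range fun i : Fin d => EuclideanSpace.basisFun (Fin n) ℝ (Fin.castLE h i)),
    by
      rw [finrank_span_eq_card, Fintype.card_fin]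
      exact (EuclideanSpace.basisFun (Fin n) ℝ).orthonormal.linearIndependent.comp _
        (Fin.castLE_injective h)⟩

/-- The rotation invariant (Haar) probability measure `ν_d` on `G(n, d)`, `0 ≤ d ≤ n`: the image
of the Haar probability measure of `O(n)` under `A ↦ A L₀`, where `L₀` is a fixed
`d`-dimensional subspace. -/
noncomputable def Grassmannian.nu (n d : ℕ) (h : d ≤ n) : Measure (Grassmannian n d) :=
  (OrthGroup.haar n).map fun A => A.act (Grassmannian.coord n d h)

theorem OrthGroup.starProjection_act {n d : ℕ} (A : OrthGroup n) (L : Grassmannian n d) :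
    (A.act L).space.starProjection =
      Matrix.toEuclideanCLM (n := Fin n) (𝕜 := ℝ) A.1 ∘L
        (L.space.starProjection ∘L Matrix.toEuclideanCLM (n := Fin n) (𝕜 := ℝ) (star A.1)) := by
  have hA : ∀ x, Matrix.toEuclideanCLM (n := Fin n) (𝕜 := ℝ) A.1
      (Matrix.toEuclideanCLM (n := Fin n) (𝕜 := ℝ) (star A.1) x) = x := by
    intro x
    have h : Matrix.toEuclideanCLM (n := Fin n) (𝕜 := ℝ) A.1 *
        Matrix.toEuclideanCLM (n := Fin n) (𝕜 := ℝ) (star A.1) = 1 := by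
      rw [← map_mul, (Unitary.mem_iff.1 A.2).2, map_one]
    exact congrArg (fun B : Eucl n →L[ℝ] Eucl n => B x) h
  have hadj : ∀ x y : Eucl n, inner ℝ x (Matrix.toEuclideanCLM (n := Fin n) (𝕜 := ℝ) A.1 y) =
      inner ℝ (Matrix.toEuclideanCLM (n := Fin n) (𝕜 := ℝ) (star A.1) x) y := by
    intro x y
    rw [map_star, ContinuousLinearMap.star_eq_adjoint, ContinuousLinearMap.adjoint_inner_left]
  ext1 x
  refine Submodule.eq_starProjection_of_mem_of_inner_eq_zero ?_ ?_
  · exact ⟨_, Submodule.starProjection_apply_mem _ _, rfl⟩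
  · rintro _ ⟨w, hw, rfl⟩
    have hw' : Matrix.toEuclideanLin A.1 w =
      Matrix.toEuclideanCLM (n := Fin n) (𝕜 := ℝ) A.1 w := rfl
    rw [hw', hadj, map_sub]
    have h2 : ∀ y, Matrix.toEuclideanCLM (n := Fin n) (𝕜 := ℝ) (star A.1)
        (Matrix.toEuclideanCLM (n := Fin n) (𝕜 := ℝ) A.1 y) = y := by
      intro y
      have h : Matrix.toEuclideanCLM (n := Fin n) (𝕜 := ℝ) (star A.1) *
          Matrix.toEuclideanCLM (n := Fin n) (𝕜 := ℝ) A.1 = 1 := by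
        rw [← map_mul, (Unitary.mem_iff.1 A.2).1, map_one]
      exact congrArg (fun B : Eucl n →L[ℝ] Eucl n => B y) h
    simp only [ContinuousLinearMap.comp_apply, h2]
    exact Submodule.starProjection_inner_eq_zero _ _ hw

theorem OrthGroup.continuous_act {n d : ℕ} (L : Grassmannian n d) :
    Continuous fun A : OrthGroup n => A.act L := by
  refine continuous_induced_rng.2 ?_
  have hC : Continuous fun B : Matrix (Fin n) (Fin n) ℝ =>
      Matrix.toEuclideanCLM (n := Fin n) (𝕜 := ℝ) B :=
    LinearMap.continuous_of_finiteDimensional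
      (Matrix.toEuclideanCLM (n := Fin n) (𝕜 := ℝ)).toAlgEquiv.toLinearMap
  have h : (fun L : Grassmannian n d => L.space.starProjection) ∘
      (fun A : OrthGroup n => A.act L) = fun A : OrthGroup n =>
      Matrix.toEuclideanCLM (n := Fin n) (𝕜 := ℝ) A.1 ∘L
        (L.space.starProjection ∘L Matrix.toEuclideanCLM (n := Fin n) (𝕜 := ℝ) (star A.1)) :=
    funext fun A => A.starProjection_act L
  rw [h]
  exact (hC.comp continuous_subtype_val).clm_comp
    (continuous_const.clm_comp (hC.comp continuous_subtype_val.star))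

instance Grassmannian.nu_isProbabilityMeasure (n d : ℕ) (h : d ≤ n) :
    IsProbabilityMeasure (Grassmannian.nu n d h) :=
  Measure.isProbabilityMeasure_map (OrthGroup.continuous_act _).measurable.aemeasurable

/-- `ν_d` is invariant under `O(n)`. -/
theorem Grassmannian.nu_invariant (n d : ℕ) (h : d ≤ n) (A : OrthGroup n) :
    (Grassmannian.nu n d h).map (fun L => A.act L) = Grassmannian.nu n d h := by
  have hA : Continuous fun L : Grassmannian n d => A.act L := by
    refine continuous_induced_rng.2 ?_
    have h : (fun L : Grassmannian n d => L.space.starProjection) ∘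
        (fun L : Grassmannian n d => A.act L) = fun L : Grassmannian n d =>
        Matrix.toEuclideanCLM (n := Fin n) (𝕜 := ℝ) A.1 ∘L
          (L.space.starProjection ∘L Matrix.toEuclideanCLM (n := Fin n) (𝕜 := ℝ) (star A.1)) :=
      funext fun L => A.starProjection_act L
    rw [h]
    exact continuous_const.clm_comp (continuous_induced_dom.clm_comp continuous_const)
  unfold Grassmannian.nu
  rw [Measure.map_map hA.measurable (OrthGroup.continuous_act _).measurable]
  have hc : (fun L : Grassmannian n d => A.act L) ∘
      (fun B : OrthGroup n => B.act (Grassmannian.coord n d h)) =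
      (fun B : OrthGroup n => B.act (Grassmannian.coord n d h)) ∘ fun B => A * B := by
    funext B
    refine Subtype.ext ?_
    change Submodule.map _ (Submodule.map _ _) = Submodule.map _ _
    rw [← Submodule.map_comp]
    congr 1
    ext x
    simp [Matrix.toEuclideanLin, Matrix.toLpLin_apply, Matrix.mulVec_mulVec]
  have : (OrthGroup.haar n).IsMulLeftInvariant := by unfold OrthGroup.haar; infer_instance
  rw [hc, ← Measure.map_map (OrthGroup.continuous_act _).measurable
    (continuous_const_mul A).measurable, map_mul_left_eq_self]

/-! ### Ratios of Gamma functions -/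

/-- The ratio `Γ(a + p) / Γ(a)` for `p ∈ ℕ`, extended continuously to the poles of `Γ`; it is
the rising factorial `a (a + 1) ⋯ (a + p - 1)`. -/
noncomputable def gammaRatio (a : ℝ) (p : ℕ) : ℝ := ∏ i ∈ Finset.range p, (a + i)

theorem gammaRatio_eq (a : ℝ) (p : ℕ) (ha : ∀ i : ℕ, a ≠ -i) :
    gammaRatio a p = Real.Gamma (a + p) / Real.Gamma a := by
  rw [eq_div_iff (Real.Gamma_ne_zero ha)]
  induction p with
  | zero => simp [gammaRatio]
  | succ p ih =>
    have hp : a + p ≠ 0 := fun h => ha p (by linarith)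
    have e : gammaRatio a (p + 1) = gammaRatio a p * (a + p) := Finset.prod_range_succ _ _
    rw [e, Nat.cast_succ, ← add_assoc, Real.Gamma_add_one hp, ← ih]
    ring

theorem gammaRatio_continuous (p : ℕ) : Continuous fun a => gammaRatio a p := by
  unfold gammaRatio
  fun_prop

/-!
Symmetric tensors are determined by their values at `(x, …, x)` (`SymTensor.ext_diag`), and the
tensor-valued integral can be evaluated on the diagonal as well. So it is enough to integrate the
scalar function `[F, L]² |p_L x|^{2m} |p_{F ∩ L} x|^{2l}` over `L`, for each vector `x`.

If `F + L` is the whole space, then `[F, L]²` is the determinant of `1 - p_{Lᗮ} p_{Fᗮ}`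
(`subspaceDet_sq`), a continuous function of `p_L` that is multiplicative along flags: passing from
`L` to the hyperplane of `L` orthogonal to `v ∈ L` multiplies it by `|p_{F ∩ L} v|² / |v|²`
(`projWeight_inf_orthogonal`), which is the squared subspace determinant of that hyperplane and
`F ∩ L` inside `L`. Subspaces `L` for which `F + L` is not the whole space form a null set
(`ae_projWeight_ne_zero`).

A random rotation of any fixed `d`-dimensional subspace has the distribution `ν_d`. Therefore a
random `d`-dimensional subspace can be generated by choosing a random `(d + 1)`-dimensional subspace
and in it the hyperplane orthogonal to a Gaussian vector (`Grassmannian.nu_eq_map_hyperplane`). The integral is therefore found by induction on the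
codimension of `L` (`integral_croftonIntegrand`), and two facts are needed.

* The formula for hyperplanes (`integral_hyperplane`). The integrand is homogeneous of degree zero
  in the normal vector, hence independent of its Gaussian length. Its binomial expansion reduces to
  moments of independent Gaussian vectors in `F` and `Fᗮ`, and the sum is put into the required form
  by Newton's forward difference expansion (`sum_choose_eq_croftonPoly_one`).
* The composition of the formula for hyperplanes with the formula for codimension `p` is the formula
  for codimension `p + 1`. This is the Pfaff–Saalschütz identity
  (`sum_croftonCoeff_mul_croftonPoly`).
-/

/-! ### Rising factorials and binomial sums -/

@[simp] theorem gammaRatio_zero (a : ℝ) : gammaRatio a 0 = 1 := by simp [gammaRatio]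

theorem gammaRatio_succ (a : ℝ) (p : ℕ) : gammaRatio a (p + 1) = gammaRatio a p * (a + p) :=
  Finset.prod_range_succ _ _

theorem gammaRatio_add (a : ℝ) (p q : ℕ) :
    gammaRatio a (p + q) = gammaRatio a p * gammaRatio (a + p) q := by
  induction q with
  | zero => simp
  | succ q ih =>
    rw [← add_assoc, gammaRatio_succ, ih, gammaRatio_succ]
    push_cast
    ring

theorem gammaRatio_succ' (a : ℝ) (p : ℕ) :
    gammaRatio a (p + 1) = a * gammaRatio (a + 1) p := by
  rw [add_comm p 1, gammaRatio_add]
  simp [gammaRatio]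

theorem gammaRatio_pos {a : ℝ} (ha : 0 < a) (p : ℕ) : 0 < gammaRatio a p :=
  Finset.prod_pos fun i _ => by positivity

theorem gammaRatio_zero_left {p : ℕ} (hp : p ≠ 0) : gammaRatio 0 p = 0 :=
  Finset.prod_eq_zero (Finset.mem_range.2 (Nat.pos_of_ne_zero hp)) (by simp)

theorem gammaRatio_inv_eq {a : ℝ} (ha : 0 < a) (p : ℕ) :
    Real.Gamma a / Real.Gamma (a + p) = (gammaRatio a p)⁻¹ := by
  rw [gammaRatio_eq a p fun i h => by linarith [(Nat.cast_nonneg i : (0 : ℝ) ≤ i)], inv_div]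

/-- Pascal's rule inside a binomial sum. -/
theorem sum_choose_succ (s : ℕ) (f : ℕ → ℕ → ℝ) :
    ∑ i ∈ Finset.range (s + 2), ((s + 1).choose i : ℝ) * f i (s + 1 - i) =
      ∑ i ∈ Finset.range (s + 1), (s.choose i : ℝ) * f i (s - i + 1) +
      ∑ i ∈ Finset.range (s + 1), (s.choose i : ℝ) * f (i + 1) (s - i) := by
  have h := Finset.sum_antidiagonal_choose_succ_mul f s
  rw [Finset.Nat.sum_antidiagonal_eq_sum_range_succ
      (fun i j => ((s + 1).choose i : ℝ) * f i j),
    Finset.Nat.sum_antidiagonal_eq_sum_range_succ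
      (fun i j => (s.choose i : ℝ) * f i (j + 1)),
    Finset.Nat.sum_antidiagonal_eq_sum_range_succ
      (fun i j => (s.choose j : ℝ) * f (i + 1) j)] at h
  rw [h]
  congr 1
  refine Finset.sum_congr rfl fun i hi => ?_
  rw [Nat.choose_symm (by simpa [Nat.lt_succ_iff] using hi)]

/-- Summation over the triangle `i + r ≤ m` along its diagonals `i + r = s`. -/
theorem sum_triangle (m : ℕ) (G : ℕ → ℕ → ℝ) :
    ∑ i ∈ Finset.range (m + 1), ∑ r ∈ Finset.range (m - i + 1), G i r =
      ∑ s ∈ Finset.range (m + 1), ∑ i ∈ Finset.range (s + 1), G i (s - i) := by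
  rw [Finset.sum_sigma', Finset.sum_sigma']
  refine Finset.sum_bij' (fun x _ => ⟨x.1 + x.2, x.1⟩) (fun x _ => ⟨x.2, x.1 - x.2⟩)
    ?_ ?_ ?_ ?_ ?_
  · rintro ⟨i, r⟩ h
    simp only [Finset.mem_sigma, Finset.mem_range] at h ⊢
    omega
  · rintro ⟨i, r⟩ h
    simp only [Finset.mem_sigma, Finset.mem_range] at h ⊢
    omega
  · rintro ⟨i, r⟩ h
    simp
  · rintro ⟨i, r⟩ h
    simp only [Finset.mem_sigma, Finset.mem_range] at h
    simp only [Sigma.mk.injEq, heq_eq_eq, and_true]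
    omega
  · rintro ⟨i, r⟩ h
    simp

theorem sum_triangle' (m : ℕ) (G : ℕ → ℕ → ℝ) :
    ∑ i ∈ Finset.range (m + 1), ∑ r ∈ Finset.range (m - i + 1), G i (i + r) =
      ∑ s ∈ Finset.range (m + 1), ∑ i ∈ Finset.range (s + 1), G i s := by
  rw [sum_triangle m fun i r => G i (i + r)]
  refine Finset.sum_congr rfl fun s _ => Finset.sum_congr rfl fun i hi => ?_
  rw [Nat.add_sub_cancel' (by simpa [Nat.lt_succ_iff] using hi)]

/-- The Chu–Vandermonde identity. -/
theorem sum_choose_mul_gammaRatio (a b : ℝ) (s : ℕ) :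
    ∑ i ∈ Finset.range (s + 1), (s.choose i : ℝ) * (gammaRatio a i * gammaRatio b (s - i)) =
      gammaRatio (a + b) s := by
  induction s with
  | zero => simp
  | succ s ih =>
    rw [sum_choose_succ s fun i j => gammaRatio a i * gammaRatio b j, gammaRatio_succ, ← ih,
      ← Finset.sum_add_distrib, Finset.sum_mul]
    refine Finset.sum_congr rfl fun i hi => ?_
    rw [gammaRatio_succ, gammaRatio_succ,
      Nat.cast_sub (by simpa [Nat.lt_succ_iff] using hi)]
    ring

/-- The Pfaff–Saalschütz identity. -/
theorem sum_choose_mul_gammaRatio_saalschutz (a b c : ℝ) (s : ℕ) :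
    ∑ i ∈ Finset.range (s + 1), (s.choose i : ℝ) * (gammaRatio a i * gammaRatio b (s - i) *
        gammaRatio c (s - i) * gammaRatio (c + (a + b) + (s - i : ℕ)) i) =
      gammaRatio (a + b) s * gammaRatio (c + a) s := by
  -- Expanding the last factor by Chu–Vandermonde and interchanging the summations leaves two
  -- further Chu–Vandermonde sums, first over `i` and then over `r`.
  have h1 : ∀ i ∈ Finset.range (s + 1), (s.choose i : ℝ) * (gammaRatio a i * gammaRatio b (s - i) *
        gammaRatio c (s - i) * gammaRatio (c + (a + b) + (s - i : ℕ)) i) =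
      ∑ r ∈ Finset.range (i + 1), (s.choose i : ℝ) * (i.choose r) *
        (gammaRatio a i * gammaRatio b (s - i) * (gammaRatio (a + b) r * gammaRatio c (s - r))) := by
    intro i hi
    have hi' : i ≤ s := by simpa [Nat.lt_succ_iff] using hi
    rw [show c + (a + b) + ((s - i : ℕ) : ℝ) = (a + b) + (c + (s - i : ℕ)) by ring,
      ← sum_choose_mul_gammaRatio, Finset.mul_sum, Finset.mul_sum]
    refine Finset.sum_congr rfl fun r hr => ?_
    have hr' : r ≤ i := by simpa [Nat.lt_succ_iff] using hr
    rw [show s - r = (s - i) + (i - r) by omega, gammaRatio_add c]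
    ring
  rw [Finset.sum_congr rfl h1, ← sum_triangle' s fun r i => (s.choose i : ℝ) * (i.choose r) *
        (gammaRatio a i * gammaRatio b (s - i) * (gammaRatio (a + b) r * gammaRatio c (s - r))),
    add_comm c a, ← sum_choose_mul_gammaRatio a c, Finset.mul_sum]
  refine Finset.sum_congr rfl fun r hr => ?_
  have hr' : r ≤ s := by simpa [Nat.lt_succ_iff] using hr
  have h2 : gammaRatio (a + b) s =
      gammaRatio (a + b) r * ∑ t ∈ Finset.range (s - r + 1), ((s - r).choose t : ℝ) *
        (gammaRatio (a + r) t * gammaRatio b (s - r - t)) := by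
    rw [sum_choose_mul_gammaRatio, show a + r + b = a + b + r by ring, ← gammaRatio_add,
      Nat.add_sub_cancel' hr']
  rw [h2, Finset.mul_sum, Finset.sum_mul]
  refine Finset.sum_congr rfl fun t ht => ?_
  have ht' : t ≤ s - r := by simpa [Nat.lt_succ_iff] using ht
  have h3 : (s.choose (r + t) : ℝ) * ((r + t).choose r) = s.choose r * (s - r).choose t := by
    have := Nat.choose_mul (n := s) (k := r + t) (s := r) (Nat.le_add_right _ _)
    rw [Nat.add_sub_cancel_left] at this
    exact_mod_cast this
  rw [h3, gammaRatio_add a, show s - (r + t) = s - r - t by omega]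
  ring

/-- Newton's forward difference expansion of a binomial sum. The hypothesis says that `F i` is
the `i`-th forward difference of `F 0`. -/
theorem sum_choose_mul_eq_sum_fwdDiff (q : ℕ) (ξ η : ℝ) (F : ℕ → ℕ → ℝ)
    (hF : ∀ i e, F i (e + 1) = F i e + F (i + 1) e) :
    ∑ i ∈ Finset.range (q + 1), (q.choose i : ℝ) * (F 0 i * ξ ^ i * η ^ (q - i)) =
      ∑ i ∈ Finset.range (q + 1), (q.choose i : ℝ) * (F i 0 * ξ ^ i * (ξ + η) ^ (q - i)) := by
  induction q generalizing F with
  | zero => simp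
  | succ q ih =>
    rw [sum_choose_succ q fun i j => F 0 i * ξ ^ i * η ^ j,
      sum_choose_succ q fun i j => F i 0 * ξ ^ i * (ξ + η) ^ j]
    have e1 := ih F hF
    have e2 := ih (fun i => F (i + 1)) (fun i e => hF (i + 1) e)
    have l1 : ∑ i ∈ Finset.range (q + 1), (q.choose i : ℝ) * (F 0 i * ξ ^ i * η ^ (q - i + 1)) +
        ∑ i ∈ Finset.range (q + 1), (q.choose i : ℝ) * (F 0 (i + 1) * ξ ^ (i + 1) * η ^ (q - i)) =
        (ξ + η) *
          ∑ i ∈ Finset.range (q + 1), (q.choose i : ℝ) * (F 0 i * ξ ^ i * η ^ (q - i)) +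
        ξ * ∑ i ∈ Finset.range (q + 1), (q.choose i : ℝ) * (F 1 i * ξ ^ i * η ^ (q - i)) := by
      rw [Finset.mul_sum, Finset.mul_sum, ← Finset.sum_add_distrib, ← Finset.sum_add_distrib]
      refine Finset.sum_congr rfl fun i _ => ?_
      rw [hF]
      ring
    rw [l1, e1, e2, Finset.mul_sum, Finset.mul_sum]
    congr 1 <;> refine Finset.sum_congr rfl fun i _ => ?_ <;> ring

/-- The Newton expansion of a binomial sum whose coefficients are ratios of rising factorials of
the same base point `z`; the differences of such ratios have a closed form. -/
theorem sum_choose_mul_gammaRatio_div (q : ℕ) (ξ η : ℝ) {z : ℝ} (hz : 0 < z) (l : ℕ) :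
    ∑ e ∈ Finset.range (q + 1), (q.choose e : ℝ) *
        (gammaRatio z (e + 1) / gammaRatio z (l + e) * ξ ^ e * η ^ (q - e)) =
      ∑ i ∈ Finset.range (q + 1), (q.choose i : ℝ) *
        ((-1) ^ i * gammaRatio (l - 1) i * z / gammaRatio z (l + i) * ξ ^ i *
          (ξ + η) ^ (q - i)) := by
  have h := sum_choose_mul_eq_sum_fwdDiff q ξ η
    (fun i e => (-1) ^ i * gammaRatio (l - 1) i * gammaRatio z (e + 1) / gammaRatio z (l + i + e))
    (fun i e => by
      rw [show l + i + (e + 1) = (l + i + e) + 1 by ring,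
        show l + (i + 1) + e = (l + i + e) + 1 by ring, gammaRatio_succ z (l + i + e),
        gammaRatio_succ z (e + 1), gammaRatio_succ _ i]
      have h1 := (gammaRatio_pos hz (l + i + e)).ne'
      have h2 : z + (l + i + e : ℕ) ≠ 0 := by positivity
      field_simp
      push_cast
      ring)
  simpa [gammaRatio_succ] using h

/-- The Chu–Vandermonde identity in the form `₂F₁(-M, b; c; 1) = (c - b)_M / (c)_M`. -/
theorem sum_choose_mul_neg_one_pow_gammaRatio_div (M : ℕ) (b : ℝ) {c : ℝ} (hc : 0 < c) :
    ∑ i ∈ Finset.range (M + 1), (M.choose i : ℝ) * ((-1) ^ i * (gammaRatio b i / gammaRatio c i)) =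
      gammaRatio (c - b) M / gammaRatio c M := by
  have h := sum_choose_mul_eq_sum_fwdDiff M (-1) 1
    (fun i e => (-1) ^ i * gammaRatio (c - b) i * gammaRatio b e / gammaRatio c (i + e))
    (fun i e => by
      rw [show i + (e + 1) = (i + e) + 1 by ring,
        show (i + 1) + e = (i + e) + 1 by ring, gammaRatio_succ c (i + e),
        gammaRatio_succ b e, gammaRatio_succ _ i]
      have h1 := (gammaRatio_pos hc (i + e)).ne'
      have h2 : c + (i + e : ℕ) ≠ 0 := by positivity
      field_simp
      push_cast
      ring)
  rw [Finset.sum_range_succ (fun i => (M.choose i : ℝ) * ((-1) ^ i * gammaRatio (c - b) i *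
    gammaRatio b 0 / gammaRatio c (i + 0) * (-1) ^ i * (-1 + 1) ^ (M - i))),
    Finset.sum_eq_zero (s := Finset.range M)] at h
  · calc
      _ = _ := Finset.sum_congr rfl fun i _ => by
        simp only [zero_add, pow_zero, gammaRatio_zero, one_mul, one_pow, mul_one]; ring
      _ = _ := h
      _ = _ := by
        have : ((-1 : ℝ) ^ M) * (-1) ^ M = 1 := by rw [← mul_pow]; simp
        simp only [zero_add, Nat.choose_self, Nat.cast_one, gammaRatio_zero, mul_one, add_zero,
          Nat.sub_self, pow_zero, one_mul]
        linear_combination (gammaRatio (c - b) M / gammaRatio c M) * this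
  · intro i hi
    have : M - i ≠ 0 := by have := Finset.mem_range.1 hi; omega
    simp [this]

theorem gammaRatio_half (n : ℕ) :
    gammaRatio (1 / 2) n * (4 ^ n * n.factorial) = (2 * n).factorial := by
  induction n with
  | zero => simp
  | succ n ih =>
    rw [gammaRatio_succ, show 2 * (n + 1) = 2 * n + 1 + 1 by ring, Nat.factorial_succ n,
      Nat.factorial_succ (2 * n + 1), Nat.factorial_succ (2 * n)]
    push_cast
    rw [← ih]
    ring

theorem choose_two_mul_mul_gammaRatio_half {q e : ℕ} (h : e ≤ q) :
    ((2 * q).choose (2 * e) : ℝ) * (gammaRatio (1 / 2) e * gammaRatio (1 / 2) (q - e)) =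
      q.choose e * gammaRatio (1 / 2) q := by
  have h1 := gammaRatio_half e
  have h2 := gammaRatio_half (q - e)
  have h3 := gammaRatio_half q
  have h4 : ((2 * q).choose (2 * e) : ℝ) * (2 * e).factorial * (2 * (q - e)).factorial =
      (2 * q).factorial := by
    have := Nat.choose_mul_factorial_mul_factorial (n := 2 * q) (k := 2 * e) (by omega)
    rw [← Nat.mul_sub] at this
    exact_mod_cast this
  have h5 : (q.choose e : ℝ) * e.factorial * (q - e).factorial = q.factorial := by
    exact_mod_cast Nat.choose_mul_factorial_mul_factorial h
  have h6 : (4 : ℝ) ^ q = 4 ^ e * 4 ^ (q - e) := by rw [← pow_add, Nat.add_sub_cancel' h]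
  rw [← h1, ← h2, ← h3, ← h5, h6] at h4
  have h7 : (4 : ℝ) ^ e * e.factorial * (4 ^ (q - e) * (q - e).factorial) ≠ 0 := by positivity
  refine mul_right_cancel₀ h7 ?_
  linear_combination h4

/-! ### The coefficients -/

/-- The coefficient of `|x|^{2(m-i)} |p_F x|^{2(l+i)}` in the integral formula, up to a leading
constant that does not depend on `m`, `l`, `i`. Here `n` is the dimension of the whole space, `p` is
the codimension of `L`, and `dim F = j + p`, so that `F ∩ L` generically has dimension `j`. -/
noncomputable def croftonCoeff (n j p : ℝ) (m l i : ℕ) : ℝ :=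
  (m.choose i : ℝ) * gammaRatio ((l : ℝ) - 1) i * gammaRatio (p / 2) i *
    (gammaRatio ((n - p) / 2 + 1) (m - i) / gammaRatio (n / 2 + 1) m) *
    (gammaRatio (j / 2) l / gammaRatio ((j + p) / 2) (l + i))

/-- The right-hand side of the integral formula without its leading constant, as a polynomial in
`Y = |x|²` and `X = |p_F x|²`. -/
noncomputable def croftonPoly (n j p : ℝ) (m l : ℕ) (Y X : ℝ) : ℝ :=
  ∑ i ∈ Finset.range (m + 1), croftonCoeff n j p m l i * (Y ^ (m - i) * X ^ (l + i))

/-- The hypergeometric summation behind the case of a hyperplane `L`. Its left-hand side is what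
the binomial expansion of the integrand produces, with `X = |p_F x|²`, `H = |x|² - |p_F x|²` and
`N`, `g` the dimensions of the space and of `F`. -/
theorem sum_choose_eq_croftonPoly_one {N g : ℝ} (hN : 0 < N) (hg : 0 < g) (m l : ℕ) (X H : ℝ) :
    ∑ q ∈ Finset.range (m + 1), (m.choose q : ℝ) * ((-1) ^ q * (X + H) ^ (m - q) *
      ((∑ e ∈ Finset.range (q + 1), (q.choose e : ℝ) * (gammaRatio (1 / 2) q *
          gammaRatio ((g - 1) / 2) l * gammaRatio (g / 2) (e + 1) / gammaRatio (g / 2) (l + e) *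
          (X ^ (l + e) * H ^ (q - e)))) / gammaRatio (N / 2) (q + 1))) =
      g / N * croftonPoly N (g - 1) 1 m l (X + H) X := by
  have hz : 0 < g / 2 := by positivity
  have hw : 0 < N / 2 := by positivity
  have h1 : ∀ q ∈ Finset.range (m + 1),
      (m.choose q : ℝ) * ((-1) ^ q * (X + H) ^ (m - q) *
      ((∑ e ∈ Finset.range (q + 1), (q.choose e : ℝ) * (gammaRatio (1 / 2) q *
          gammaRatio ((g - 1) / 2) l * gammaRatio (g / 2) (e + 1) / gammaRatio (g / 2) (l + e) *
          (X ^ (l + e) * H ^ (q - e)))) / gammaRatio (N / 2) (q + 1))) =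
      ∑ i ∈ Finset.range (q + 1), (m.choose q : ℝ) * (q.choose i) * ((-1) ^ (q + i) *
        (X + H) ^ (m - i) * X ^ (l + i) * (gammaRatio (1 / 2) q / gammaRatio (N / 2) (q + 1)) *
        (gammaRatio ((g - 1) / 2) l * gammaRatio (l - 1) i * (g / 2) /
          gammaRatio (g / 2) (l + i))) := by
    intro q hq
    have hq' : q ≤ m := by simpa [Nat.lt_succ_iff] using hq
    have h2 : ∑ e ∈ Finset.range (q + 1), (q.choose e : ℝ) * (gammaRatio (1 / 2) q *
          gammaRatio ((g - 1) / 2) l * gammaRatio (g / 2) (e + 1) / gammaRatio (g / 2) (l + e) *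
          (X ^ (l + e) * H ^ (q - e))) =
        gammaRatio (1 / 2) q * gammaRatio ((g - 1) / 2) l * X ^ l *
          ∑ e ∈ Finset.range (q + 1), (q.choose e : ℝ) *
            (gammaRatio (g / 2) (e + 1) / gammaRatio (g / 2) (l + e) * X ^ e * H ^ (q - e)) := by
      rw [Finset.mul_sum]
      refine Finset.sum_congr rfl fun e _ => ?_
      rw [pow_add]
      ring
    rw [h2, sum_choose_mul_gammaRatio_div q X H hz l, Finset.mul_sum, Finset.sum_div,
      Finset.mul_sum, Finset.mul_sum]
    refine Finset.sum_congr rfl fun i hi => ?_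
    have hi' : i ≤ q := by simpa [Nat.lt_succ_iff] using hi
    rw [show m - i = (m - q) + (q - i) by omega, pow_add, pow_add, pow_add]
    ring
  rw [Finset.sum_congr rfl h1, ← sum_triangle' m fun i q => (m.choose q : ℝ) * (q.choose i) *
        ((-1) ^ (q + i) *
        (X + H) ^ (m - i) * X ^ (l + i) * (gammaRatio (1 / 2) q / gammaRatio (N / 2) (q + 1)) *
        (gammaRatio ((g - 1) / 2) l * gammaRatio (l - 1) i * (g / 2) /
          gammaRatio (g / 2) (l + i))), croftonPoly, Finset.mul_sum]
  refine Finset.sum_congr rfl fun i hi => ?_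
  have hi' : i ≤ m := by simpa [Nat.lt_succ_iff] using hi
  have hw' : 0 < N / 2 + i + 1 := by positivity
  have h3 := sum_choose_mul_neg_one_pow_gammaRatio_div (m - i) (1 / 2 + i) hw'
  rw [show N / 2 + i + 1 - (1 / 2 + i) = (N - 1) / 2 + 1 by ring] at h3
  have h4 : gammaRatio (N / 2) (i + 1) * gammaRatio (N / 2 + i + 1) (m - i) =
      N / 2 * gammaRatio (N / 2 + 1) m := by
    have := gammaRatio_add (N / 2) (i + 1) (m - i)
    rw [show i + 1 + (m - i) = m + 1 by omega, gammaRatio_succ'] at this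
    push_cast at this
    rw [this, add_assoc]
  have h5 : ∀ r ∈ Finset.range (m - i + 1), (m.choose (i + r) : ℝ) * ((i + r).choose i) *
        ((-1) ^ (i + r + i) * (X + H) ^ (m - i) * X ^ (l + i) *
        (gammaRatio (1 / 2) (i + r) / gammaRatio (N / 2) (i + r + 1)) *
        (gammaRatio ((g - 1) / 2) l * gammaRatio (l - 1) i * (g / 2) /
          gammaRatio (g / 2) (l + i))) =
      (m.choose i * gammaRatio (1 / 2) i / gammaRatio (N / 2) (i + 1) *
        ((X + H) ^ (m - i) * X ^ (l + i)) *
        (gammaRatio ((g - 1) / 2) l * gammaRatio (l - 1) i * (g / 2) /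
          gammaRatio (g / 2) (l + i))) * (((m - i).choose r : ℝ) * ((-1) ^ r *
          (gammaRatio (1 / 2 + i) r / gammaRatio (N / 2 + i + 1) r))) := by
    intro r hr
    have h6 : (m.choose (i + r) : ℝ) * ((i + r).choose i) = m.choose i * (m - i).choose r := by
      have := Nat.choose_mul (n := m) (k := i + r) (s := i) (Nat.le_add_right _ _)
      rw [Nat.add_sub_cancel_left] at this
      exact_mod_cast this
    rw [h6, show i + r + i = 2 * i + r by ring, show i + r + 1 = (i + 1) + r by ring,
      gammaRatio_add (N / 2) (i + 1) r, gammaRatio_add (1 / 2) i r, pow_add, pow_mul]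
    push_cast
    rw [← add_assoc (N / 2)]
    ring
  rw [Finset.sum_congr rfl h5, ← Finset.mul_sum, h3, croftonCoeff]
  have p1 := (gammaRatio_pos hw (i + 1)).ne'
  have p2 := (gammaRatio_pos hw' (m - i)).ne'
  have p3 := (gammaRatio_pos (a := N / 2 + 1) (by positivity) m).ne'
  have p4 := (gammaRatio_pos hz (l + i)).ne'
  rw [sub_add_cancel]
  have key : gammaRatio (1 / 2) i / gammaRatio (N / 2) (i + 1) *
      (gammaRatio ((N - 1) / 2 + 1) (m - i) / gammaRatio (N / 2 + i + 1) (m - i)) * (g / 2) =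
      g / N * (gammaRatio (1 / 2) i *
        (gammaRatio ((N - 1) / 2 + 1) (m - i) / gammaRatio (N / 2 + 1) m)) := by
    rw [div_mul_div_comm, h4]
    field_simp
  linear_combination (m.choose i * gammaRatio (l - 1) i * gammaRatio ((g - 1) / 2) l /
    gammaRatio (g / 2) (l + i) * ((X + H) ^ (m - i) * X ^ (l + i))) * key

/-- A rearrangement of factors, stated for variables in place of rising factorials. -/
theorem mul_div_cancel_aux {a1 a2 a3 a4 a5 a6 a7 a8 a9 b1 b2 b3 b4 b5 c1 c2 c3 c4 : ℝ}
    (h : c1 * c2 = c3 * c4) (ha1 : a1 ≠ 0) (hb3 : b3 ≠ 0) (hb2 : b2 ≠ 0) (ha9 : a9 ≠ 0)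
    (hb1 : b1 ≠ 0) :
    c1 * a6 * a3 * (b4 * a2 / a9) * (a5 / b3) * (c2 * a7 * a4 * (a8 / b1) * (b3 / b2) * b5) =
      (c3 * (a6 * a7) * a5 / b2 * b5 * b4 * a8 / (a9 * (b1 * a1))) * (c4 * (a3 * a4 * a2 * a1)) := by
  field_simp
  linear_combination (a5 * a3 * a6 * a7 * a4 * a8 * b4 * a2 * b5) * h

/-- Composition of the formula for hyperplanes of an `(n - p)`-dimensional space with the formula
for codimension `p` gives the formula for codimension `p + 1`. After collecting the terms of equal
degree in `X`, the inner sum is a Pfaff–Saalschütz sum. -/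
theorem sum_croftonCoeff_mul_croftonPoly {n j p : ℝ} (hj : 0 ≤ j) (hp : 0 ≤ p) (hn : p < n)
    (m l : ℕ) (Y X : ℝ) :
    ∑ i ∈ Finset.range (m + 1), croftonCoeff (n - p) j 1 m l i *
        croftonPoly n (j + 1) p (m - i) (l + i) Y X =
      croftonPoly n j (p + 1) m l Y X := by
  have h1 : ∀ i ∈ Finset.range (m + 1), croftonCoeff (n - p) j 1 m l i *
        croftonPoly n (j + 1) p (m - i) (l + i) Y X =
      ∑ r ∈ Finset.range (m - i + 1), croftonCoeff (n - p) j 1 m l i *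
        (croftonCoeff n (j + 1) p (m - i) (l + i) (i + r - i) *
          (Y ^ (m - (i + r)) * X ^ (l + (i + r)))) := by
    intro i _
    rw [croftonPoly, Finset.mul_sum]
    refine Finset.sum_congr rfl fun r _ => ?_
    rw [Nat.add_sub_cancel_left, Nat.sub_sub, add_assoc l]
  rw [Finset.sum_congr rfl h1, sum_triangle' m fun i s => croftonCoeff (n - p) j 1 m l i *
        (croftonCoeff n (j + 1) p (m - i) (l + i) (s - i) * (Y ^ (m - s) * X ^ (l + s))),
    croftonPoly]
  refine Finset.sum_congr rfl fun s hs => ?_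
  have hs' : s ≤ m := by simpa [Nat.lt_succ_iff] using hs
  set b : ℝ := (n - p - 1) / 2 + 1 with hb
  have hb0 : 0 < b := by rw [hb]; linarith
  have hS := sum_choose_mul_gammaRatio_saalschutz (1 / 2) (p / 2) (b + (m - s : ℕ)) s
  have q1 : ∀ i, gammaRatio ((j + 1) / 2) i ≠ 0 := fun i => (gammaRatio_pos (by positivity) i).ne'
  have q2 : ∀ i, gammaRatio ((j + 1 + p) / 2) i ≠ 0 := fun i =>
    (gammaRatio_pos (by positivity) i).ne'
  have q3 : ∀ i, gammaRatio ((n - p) / 2 + 1) i ≠ 0 := fun i =>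
    (gammaRatio_pos (by linarith) i).ne'
  have q4 : ∀ i, gammaRatio (n / 2 + 1) i ≠ 0 := fun i =>
    (gammaRatio_pos (by linarith) i).ne'
  have hterm : ∀ i ∈ Finset.range (s + 1), croftonCoeff (n - p) j 1 m l i *
        (croftonCoeff n (j + 1) p (m - i) (l + i) (s - i) * (Y ^ (m - s) * X ^ (l + s))) =
      (m.choose s * gammaRatio (l - 1) s * gammaRatio (j / 2) l /
          gammaRatio ((j + 1 + p) / 2) (l + s) * (Y ^ (m - s) * X ^ (l + s)) * gammaRatio b (m - s) *
        gammaRatio ((n - p) / 2 + 1) (m - s) /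
        (gammaRatio ((n - p) / 2 + 1) m * gammaRatio (n / 2 + 1) m)) *
      ((s.choose i : ℝ) * (gammaRatio (1 / 2) i * gammaRatio (p / 2) (s - i) *
        gammaRatio (b + (m - s : ℕ)) (s - i) *
        gammaRatio (b + (m - s : ℕ) + (1 / 2 + p / 2) + (s - i : ℕ)) i)) := by
    intro i hi
    have hi' : i ≤ s := by simpa [Nat.lt_succ_iff] using hi
    have e1 : (m.choose i : ℝ) * (m - i).choose (s - i) = m.choose s * s.choose i := by
      have := Nat.choose_mul (n := m) (k := s) (s := i) hi'
      exact_mod_cast this.symm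
    have e2 : gammaRatio ((l : ℝ) - 1) i * gammaRatio (((l + i : ℕ) : ℝ) - 1) (s - i) =
        gammaRatio (l - 1) s := by
      rw [show (((l + i : ℕ) : ℝ) - 1) = (l : ℝ) - 1 + i by push_cast; ring, ← gammaRatio_add,
        Nat.add_sub_cancel' hi']
    have e3 : gammaRatio b (m - i) =
        gammaRatio b (m - s) * gammaRatio (b + (m - s : ℕ)) (s - i) := by
      rw [← gammaRatio_add]
      congr 1
      omega
    have e4 : gammaRatio (n / 2 + 1) m = gammaRatio (n / 2 + 1) (m - i) *
        gammaRatio (b + (m - s : ℕ) + (1 / 2 + p / 2) + (s - i : ℕ)) i := by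
      have : b + (m - s : ℕ) + (1 / 2 + p / 2) + (s - i : ℕ) = n / 2 + 1 + (m - i : ℕ) := by
        rw [hb, Nat.cast_sub hs', Nat.cast_sub hi', Nat.cast_sub (hi'.trans hs')]
        ring
      rw [this, ← gammaRatio_add, Nat.sub_add_cancel (hi'.trans hs')]
    have e5 : gammaRatio (b + (m - s : ℕ) + (1 / 2 + p / 2) + (s - i : ℕ)) i ≠ 0 :=
      (gammaRatio_pos (by positivity) i).ne'
    rw [croftonCoeff, croftonCoeff, ← e2, e4, ← hb, e3,
      show l + i + (s - i) = l + s by omega, show m - i - (s - i) = m - s by omega]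
    exact mul_div_cancel_aux e1 e5 (q1 (l + i)) (q2 (l + s)) (q3 m) (q4 (m - i))
  rw [Finset.sum_congr rfl hterm, ← Finset.mul_sum, hS, croftonCoeff]
  have e6 : gammaRatio ((n - p) / 2 + 1) (m - s) * gammaRatio (b + (m - s : ℕ) + 1 / 2) s =
      gammaRatio ((n - p) / 2 + 1) m := by
    have : b + (m - s : ℕ) + 1 / 2 = (n - p) / 2 + 1 + (m - s : ℕ) := by rw [hb]; ring
    rw [this, ← gammaRatio_add, Nat.sub_add_cancel hs']
  rw [← e6, show 1 / 2 + p / 2 = (p + 1) / 2 by ring,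
    show (n - (p + 1)) / 2 + 1 = b by rw [hb]; ring, show j + (p + 1) = j + 1 + p by ring]
  have r1 := q3 (m - s)
  have r2 : gammaRatio (b + (m - s : ℕ) + 1 / 2) s ≠ 0 := (gammaRatio_pos (by positivity) s).ne'
  have r3 := q4 m
  have r4 := q2 (l + s)
  generalize gammaRatio ((n - p) / 2 + 1) (m - s) = x at r1 ⊢
  generalize gammaRatio (b + (m - s : ℕ) + 1 / 2) s = y at r2 ⊢
  generalize gammaRatio (n / 2 + 1) m = z at r3 ⊢
  field_simp

/-! ### The Gaussian measure with density `exp (-π ‖v‖²)` -/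

section Gauss

variable (V : Type*) [NormedAddCommGroup V] [InnerProductSpace ℝ V] [FiniteDimensional ℝ V]
  [MeasurableSpace V] [BorelSpace V]

/-- The Gaussian probability measure with density `exp (-π ‖v‖²)`; with this scaling no
normalizing constant is needed. -/
noncomputable def gaussMeasure : Measure V :=
  volume.withDensity fun v => ENNReal.ofReal (Real.exp (-Real.pi * ‖v‖ ^ 2))

variable {V}

theorem integral_gaussMeasure (f : V → ℝ) :
    ∫ v, f v ∂(gaussMeasure V) = ∫ v, Real.exp (-Real.pi * ‖v‖ ^ 2) * f v := by
  rw [gaussMeasure, integral_withDensity_eq_integral_toReal_smul (by fun_prop) (by simp)]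
  simp [Real.exp_nonneg]

theorem integrable_gaussMeasure_iff (f : V → ℝ) :
    Integrable f (gaussMeasure V) ↔
      Integrable fun v => Real.exp (-Real.pi * ‖v‖ ^ 2) * f v := by
  rw [gaussMeasure, integrable_withDensity_iff_integrable_smul' (by fun_prop) (by simp)]
  simp [Real.exp_nonneg]

instance gaussMeasure_isProbabilityMeasure : IsProbabilityMeasure (gaussMeasure V) := by
  constructor
  have h1 : ∫ v : V, Real.exp (-Real.pi * ‖v‖ ^ 2) = 1 := by
    rw [GaussianFourier.integral_rexp_neg_mul_sq_norm Real.pi_pos, div_self Real.pi_ne_zero,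
      Real.one_rpow]
  have h2 : Integrable fun v : V => Real.exp (-Real.pi * ‖v‖ ^ 2) := by
    by_contra h
    rw [integral_undef h] at h1
    exact zero_ne_one h1
  rw [gaussMeasure, withDensity_apply _ MeasurableSet.univ, Measure.restrict_univ,
    ← ofReal_integral_eq_lintegral_ofReal h2 (Eventually.of_forall fun _ => Real.exp_nonneg _), h1,
    ENNReal.ofReal_one]

theorem LinearIsometryEquiv.measurePreserving_gaussMeasure {W : Type*} [NormedAddCommGroup W]
    [InnerProductSpace ℝ W] [FiniteDimensional ℝ W] [MeasurableSpace W] [BorelSpace W]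
    (e : V ≃ₗᵢ[ℝ] W) : MeasurePreserving e (gaussMeasure V) (gaussMeasure W) := by
  refine ⟨e.continuous.measurable, ?_⟩
  have h := e.measurePreserving
  ext s hs
  rw [Measure.map_apply e.continuous.measurable hs, gaussMeasure, gaussMeasure,
    withDensity_apply _ hs, withDensity_apply _ (e.continuous.measurable hs),
    ← h.setLIntegral_comp_preimage hs (by fun_prop)]
  simp

/-- The coordinates of a Gaussian vector in `K` and `Kᗮ` are independent Gaussian vectors. -/
theorem measurePreserving_add_gaussMeasure (K : Submodule ℝ V) :
    MeasurePreserving (fun p : K × Kᗮ => (p.1 : V) + p.2)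
      ((gaussMeasure K).prod (gaussMeasure Kᗮ)) (gaussMeasure V) := by
  have h : MeasurePreserving (fun p : K × Kᗮ => (p.1 : V) + p.2) (volume.prod volume) volume := by
    have h1 := (K.orthogonalDecomposition.symm.measurePreserving).comp
      (WithLp.volume_preserving_toLp K Kᗮ)
    have e : (fun p : K × Kᗮ => (p.1 : V) + p.2) =
        K.orthogonalDecomposition.symm ∘ WithLp.toLp 2 := by
      funext p
      simp
    rw [e]
    exact h1
  refine ⟨h.measurable, ?_⟩
  ext s hs
  rw [Measure.map_apply h.measurable hs, gaussMeasure, gaussMeasure, gaussMeasure,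
    prod_withDensity (by fun_prop) (by fun_prop),
    withDensity_apply _ hs, withDensity_apply _ (h.measurable hs),
    ← h.setLIntegral_comp_preimage hs (by fun_prop)]
  refine lintegral_congr fun p => ?_
  have h2 : ‖(p.1 : V) + p.2‖ ^ 2 = ‖p.1‖ ^ 2 + ‖p.2‖ ^ 2 := by
    have := norm_add_sq_eq_norm_sq_add_norm_sq_of_inner_eq_zero (p.1 : V) (p.2 : V)
      (K.inner_right_of_mem_orthogonal p.1.2 p.2.2)
    simpa [sq] using this
  rw [← ENNReal.ofReal_mul (Real.exp_nonneg _), ← Real.exp_add, h2]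
  ring_nf

theorem integrable_norm_pow_gaussMeasure (k : ℕ) :
    Integrable (fun v : V => ‖v‖ ^ k) (gaussMeasure V) := by
  rcases subsingleton_or_nontrivial V with hV | hV
  · have : (fun v : V => ‖v‖ ^ k) = fun _ => ‖(0 : V)‖ ^ k := by
      funext v
      rw [Subsingleton.elim v 0]
    rw [this]
    exact integrable_const _
  rw [integrable_gaussMeasure_iff, integrable_fun_norm_addHaar (μ := (volume : Measure V))
    (f := fun y : ℝ => Real.exp (-Real.pi * y ^ 2) * y ^ k)]
  have h := integrableOn_rpow_mul_exp_neg_mul_sq (s := ((Module.finrank ℝ V - 1 + k : ℕ) : ℝ))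
    Real.pi_pos (by
      have : (0 : ℝ) ≤ ((Module.finrank ℝ V - 1 + k : ℕ) : ℝ) := by positivity
      linarith)
  refine h.congr_fun (fun y _ => ?_) measurableSet_Ioi
  simp only [Real.rpow_natCast, smul_eq_mul]
  rw [pow_add]
  ring

theorem integrable_gaussMeasure_of_le {f : V → ℝ} (hf : Measurable f) (C : ℝ) (k : ℕ)
    (h : ∀ v, |f v| ≤ C * ‖v‖ ^ k) : Integrable f (gaussMeasure V) :=
  ((integrable_norm_pow_gaussMeasure k).const_mul C).mono' hf.aestronglyMeasurable
    (Eventually.of_forall h)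

/-- The even absolute moments of a Gaussian vector, including the case of dimension zero. -/
theorem integral_norm_pow_gaussMeasure (r : ℕ) :
    ∫ v : V, ‖v‖ ^ (2 * r) ∂(gaussMeasure V) =
      gammaRatio ((Module.finrank ℝ V : ℝ) / 2) r / Real.pi ^ r := by
  rcases subsingleton_or_nontrivial V with hV | hV
  · have h0 : ∀ v : V, ‖v‖ = 0 := fun v => by rw [Subsingleton.elim v 0, norm_zero]
    simp only [h0, integral_const, probReal_univ, smul_eq_mul, one_mul,
      Module.finrank_zero_of_subsingleton]
    rcases Nat.eq_zero_or_pos r with rfl | hr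
    · simp
    · rw [Nat.cast_zero, zero_div, gammaRatio_zero_left hr.ne', zero_div, zero_pow (by omega)]
  set N := Module.finrank ℝ V with hN
  have hNpos : 0 < N := Module.finrank_pos
  have key : ∀ r : ℕ, ∫ v : V, ‖v‖ ^ (2 * r) ∂(gaussMeasure V) =
      (N * (volume : Measure V).real (Metric.ball 0 1)) *
        (Real.pi ^ (-((N : ℝ) / 2 + r)) * (1 / 2) * Real.Gamma ((N : ℝ) / 2 + r)) := by
    intro r
    rw [integral_gaussMeasure, integral_fun_norm_addHaar (volume : Measure V)
      (fun y : ℝ => Real.exp (-Real.pi * y ^ 2) * y ^ (2 * r)), nsmul_eq_mul, smul_eq_mul, ← hN,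
      ← mul_assoc]
    congr 1
    have h := integral_rpow_mul_exp_neg_mul_rpow (p := 2) (q := ((N - 1 + 2 * r : ℕ) : ℝ))
      (b := Real.pi) two_pos (by
        have : (0 : ℝ) ≤ ((N - 1 + 2 * r : ℕ) : ℝ) := by positivity
        linarith) Real.pi_pos
    have e : (((N - 1 + 2 * r : ℕ) : ℝ) + 1) / 2 = (N : ℝ) / 2 + r := by
      rw [Nat.cast_add, Nat.cast_sub hNpos]
      push_cast
      ring
    rw [neg_div, e] at h
    rw [← h]
    refine setIntegral_congr_fun measurableSet_Ioi fun y _ => ?_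
    simp only [smul_eq_mul, Real.rpow_natCast, Real.rpow_two]
    rw [pow_add]
    ring
  have h0 := key 0
  simp only [mul_zero, pow_zero, integral_const, probReal_univ, smul_eq_mul, mul_one,
    Nat.cast_zero, add_zero] at h0
  have hN2 : (0 : ℝ) < (N : ℝ) / 2 := by positivity
  rw [key r, gammaRatio_eq _ _ fun i h => by
      have : (0 : ℝ) ≤ i := by positivity
      linarith]
  have hG := (Real.Gamma_pos_of_pos hN2).ne'
  rw [neg_add, Real.rpow_add Real.pi_pos, Real.rpow_neg Real.pi_pos.le (r : ℝ),
    Real.rpow_natCast, eq_div_iff (by positivity), eq_div_iff hG]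
  have hp : Real.pi ^ r ≠ 0 := by positivity
  have hp' : (Real.pi ^ r)⁻¹ * Real.pi ^ r = 1 := inv_mul_cancel₀ hp
  linear_combination (-Real.Gamma ((N : ℝ) / 2 + r)) * h0 + Real.Gamma ((N : ℝ) / 2 + r) *
    ((N * (volume : Measure V).real (Metric.ball 0 1)) * (Real.pi ^ (-((N : ℝ) / 2)) * (1 / 2) *
      Real.Gamma ((N : ℝ) / 2))) * hp'

/-- Under the Gaussian measure, functions of the direction `v / ‖v‖` are independent of the
norm. -/
theorem integral_mul_norm_pow_gaussMeasure [Nontrivial V] {Z : V → ℝ}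
    (hZ : ∀ (c : ℝ) (v : V), 0 < c → Z (c • v) = Z v) (k : ℕ) :
    ∫ v, Z v * ‖v‖ ^ k ∂(gaussMeasure V) =
      (∫ v, Z v ∂(gaussMeasure V)) * ∫ v, ‖v‖ ^ k ∂(gaussMeasure V) := by
  -- In polar coordinates both sides split into an integral over the sphere and a radial one.
  have key : ∀ (Y : V → ℝ) (_ : ∀ (c : ℝ) (v : V), 0 < c → Y (c • v) = Y v) (k : ℕ),
      ∫ v, Y v * ‖v‖ ^ k ∂(gaussMeasure V) =
        (∫ u, Y u ∂((volume : Measure V).toSphere)) *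
        ∫ t : Set.Ioi (0 : ℝ), Real.exp (-Real.pi * t.1 ^ 2) * t.1 ^ k
          ∂(Measure.volumeIoiPow (Module.finrank ℝ V - 1)) := by
    intro Y hY k
    rw [integral_gaussMeasure, ← integral_prod_mul
      (fun u : Metric.sphere (0 : V) 1 => Y u)
      (fun t : Set.Ioi (0 : ℝ) => Real.exp (-Real.pi * t.1 ^ 2) * t.1 ^ k),
      ← (volume : Measure V).measurePreserving_homeomorphUnitSphereProd.integral_comp
      (Homeomorph.measurableEmbedding _)]
    have e := integral_subtype_comap (μ := (volume : Measure V))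
      (measurableSet_singleton (0 : V)).compl
      fun v => Real.exp (-Real.pi * ‖v‖ ^ 2) * (Y v * ‖v‖ ^ k)
    rw [restrict_compl_singleton] at e
    rw [← e]
    refine integral_congr_ae (Eventually.of_forall fun x => ?_)
    have hx : (0 : ℝ) < ‖x.1‖ := norm_pos_iff.2 x.2
    simp only [homeomorphUnitSphereProd_apply_fst_coe, homeomorphUnitSphereProd_apply_snd_coe]
    rw [hY _ _ (inv_pos.2 hx)]
    ring
  have h1 := key Z hZ k
  have h2 := key Z hZ 0
  have h3 := key (fun _ => 1) (fun _ _ _ => rfl) k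
  have h4 := key (fun _ => 1) (fun _ _ _ => rfl) 0
  simp only [pow_zero, mul_one, one_mul, integral_const, probReal_univ, smul_eq_mul] at h1 h2 h3 h4
  rw [h1, h2, h3]
  linear_combination (∫ u, Z u ∂((volume : Measure V).toSphere)) *
    (∫ t : Set.Ioi (0 : ℝ), Real.exp (-Real.pi * t.1 ^ 2) * t.1 ^ k
          ∂(Measure.volumeIoiPow (Module.finrank ℝ V - 1))) * h4

end Gauss

/-! ### The integral formula for hyperplanes -/

theorem sum_range_two_mul_of_odd_eq_zero (q : ℕ) (f : ℕ → ℝ) (hf : ∀ e, f (2 * e + 1) = 0) :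
    ∑ r ∈ Finset.range (2 * q + 1), f r = ∑ e ∈ Finset.range (q + 1), f (2 * e) := by
  induction q with
  | zero => simp
  | succ q ih =>
    rw [show 2 * (q + 1) + 1 = 2 * q + 1 + 1 + 1 by ring, Finset.sum_range_succ,
      Finset.sum_range_succ, ih, hf, add_zero, Finset.sum_range_succ _ (q + 1)]
    ring_nf

theorem inner_sq_div_norm_sq_le {V : Type*} [NormedAddCommGroup V] [InnerProductSpace ℝ V]
    (v y : V) : inner ℝ v y ^ 2 / ‖v‖ ^ 2 ≤ ‖y‖ ^ 2 := by
  refine div_le_of_le_mul₀ (by positivity) (by positivity) ?_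
  rw [mul_comm, ← mul_pow, sq_le_sq]
  simpa [abs_mul] using abs_real_inner_le_norm v y

/-- For `v ≠ 0`, the number between the bars is the squared distance of `y` from the line spanned
by `v`. -/
theorem abs_norm_sq_sub_le {V : Type*} [NormedAddCommGroup V] [InnerProductSpace ℝ V] (v y : V) :
    |‖y‖ ^ 2 - inner ℝ v y ^ 2 / ‖v‖ ^ 2| ≤ ‖y‖ ^ 2 := by
  have h1 := inner_sq_div_norm_sq_le v y
  have h2 : 0 ≤ inner ℝ v y ^ 2 / ‖v‖ ^ 2 := by positivity
  rw [abs_le]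
  constructor <;> linarith

section Hyperplane

variable {V : Type*} [NormedAddCommGroup V] [InnerProductSpace ℝ V] [FiniteDimensional ℝ V]
  [MeasurableSpace V] [BorelSpace V]

theorem integral_gaussMeasure_eq_prod (K : Submodule ℝ V) {f : V → ℝ} (hf : Measurable f) :
    ∫ v, f v ∂(gaussMeasure V) =
      ∫ p : K × Kᗮ, f ((p.1 : V) + p.2) ∂((gaussMeasure K).prod (gaussMeasure Kᗮ)) := by
  have h := measurePreserving_add_gaussMeasure K
  rw [← h.map_eq, integral_map h.measurable.aemeasurable hf.aestronglyMeasurable]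

/-- The second factor is the `2l`-th power of the length of the component of `h` orthogonal to `y`,
scaled by `‖y‖`, and is therefore independent of the first. -/
theorem integral_inner_pow_mul_pow_gaussMeasure (y : V) (e l : ℕ) :
    ∫ h : V, inner ℝ h y ^ (2 * e) * (‖h‖ ^ 2 * ‖y‖ ^ 2 - inner ℝ h y ^ 2) ^ l ∂(gaussMeasure V) =
      gammaRatio (1 / 2) e * gammaRatio (((Module.finrank ℝ V : ℝ) - 1) / 2) l /
        Real.pi ^ (e + l) * ‖y‖ ^ (2 * (e + l)) := by
  by_cases hy : y = 0
  · subst hy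
    simp only [inner_zero_right, norm_zero]
    rcases Nat.eq_zero_or_pos e with rfl | he
    · rcases Nat.eq_zero_or_pos l with rfl | hl
      · simp
      · simp [hl.ne']
    · simp [he.ne']
  set K : Submodule ℝ V := Submodule.span ℝ {y} with hK
  have hyK : y ∈ K := Submodule.mem_span_singleton_self y
  have hinner : ∀ p : K × Kᗮ, inner ℝ ((p.1 : V) + p.2) y ^ 2 = ‖p.1‖ ^ 2 * ‖y‖ ^ 2 := by
    rintro ⟨⟨a, ha⟩, ⟨b, hb⟩⟩
    obtain ⟨c, rfl⟩ := Submodule.mem_span_singleton.1 ha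
    have : inner ℝ b y = 0 := K.inner_left_of_mem_orthogonal hyK hb
    simp only [inner_add_left, this, add_zero, real_inner_smul_left, real_inner_self_eq_norm_sq,
      Submodule.coe_norm, norm_smul, Real.norm_eq_abs, mul_pow, sq_abs]
    ring
  have hnorm : ∀ p : K × Kᗮ, ‖(p.1 : V) + p.2‖ ^ 2 = ‖p.1‖ ^ 2 + ‖p.2‖ ^ 2 := by
    intro p
    have := norm_add_sq_eq_norm_sq_add_norm_sq_of_inner_eq_zero (p.1 : V) (p.2 : V)
      (K.inner_right_of_mem_orthogonal p.1.2 p.2.2)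
    simpa [sq] using this
  rw [integral_gaussMeasure_eq_prod K (by fun_prop)]
  have hint : ∀ p : K × Kᗮ, inner ℝ ((p.1 : V) + p.2) y ^ (2 * e) *
      (‖(p.1 : V) + p.2‖ ^ 2 * ‖y‖ ^ 2 - inner ℝ ((p.1 : V) + p.2) y ^ 2) ^ l =
      (‖y‖ ^ (2 * (e + l)) * ‖p.1‖ ^ (2 * e)) * ‖p.2‖ ^ (2 * l) := by
    intro p
    rw [pow_mul, hinner, hnorm]
    ring
  have hd1 : Module.finrank ℝ K = 1 := finrank_span_singleton hy
  have hd2 : (Module.finrank ℝ Kᗮ : ℝ) = (Module.finrank ℝ V : ℝ) - 1 := by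
    have := K.finrank_add_finrank_orthogonal
    rw [hd1] at this
    rw [← this]
    push_cast
    ring
  simp only [hint]
  rw [integral_prod_mul (fun a : K => ‖y‖ ^ (2 * (e + l)) * ‖a‖ ^ (2 * e))
    (fun b : Kᗮ => ‖b‖ ^ (2 * l)), integral_const_mul, integral_norm_pow_gaussMeasure,
    integral_norm_pow_gaussMeasure, hd1, hd2, pow_add]
  have hp := Real.pi_ne_zero
  push_cast
  field_simp

theorem integral_inner_pow_two_mul_gaussMeasure (y : V) (f : ℕ) :
    ∫ h : V, inner ℝ h y ^ (2 * f) ∂(gaussMeasure V) =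
      gammaRatio (1 / 2) f / Real.pi ^ f * ‖y‖ ^ (2 * f) := by
  simpa using integral_inner_pow_mul_pow_gaussMeasure y f 0

theorem integral_inner_pow_odd_gaussMeasure (y : V) (f : ℕ) :
    ∫ h : V, inner ℝ h y ^ (2 * f + 1) ∂(gaussMeasure V) = 0 := by
  have h := (LinearIsometryEquiv.neg ℝ (E := V)).measurePreserving_gaussMeasure.integral_comp
    (LinearIsometryEquiv.neg ℝ (E := V)).toHomeomorph.measurableEmbedding
    (fun h : V => inner ℝ h y ^ (2 * f + 1))
  simp only [LinearIsometryEquiv.coe_neg, inner_neg_left] at h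
  simp only [Odd.neg_pow (odd_two_mul_add_one f), integral_neg] at h
  linarith

theorem integrable_norm_sq_mul_inner_pow (y : V) (r l : ℕ) :
    Integrable (fun h : V => ‖h‖ ^ 2 * inner ℝ h y ^ r *
      (‖y‖ ^ 2 - inner ℝ h y ^ 2 / ‖h‖ ^ 2) ^ l) (gaussMeasure V) := by
  refine integrable_gaussMeasure_of_le (by fun_prop) (‖y‖ ^ r * (‖y‖ ^ 2) ^ l) (2 + r) fun v => ?_
  rw [abs_mul, abs_mul, abs_pow, abs_pow, abs_pow, abs_norm]
  calc _ ≤ ‖v‖ ^ 2 * (‖v‖ * ‖y‖) ^ r * (‖y‖ ^ 2) ^ l := by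
        gcongr
        · exact abs_real_inner_le_norm v y
        · exact abs_norm_sq_sub_le v y
    _ = _ := by ring

theorem integrable_inner_pow (y : V) (r : ℕ) :
    Integrable (fun h : V => inner ℝ h y ^ r) (gaussMeasure V) := by
  refine integrable_gaussMeasure_of_le (by fun_prop) (‖y‖ ^ r) r fun v => ?_
  rw [abs_pow, ← mul_pow, mul_comm]
  gcongr
  exact abs_real_inner_le_norm v y

/-- The last factor depends only on the direction of `h`; after trading powers of `‖h‖`, which are
independent of the direction, the integrand becomes a polynomial. -/
theorem integral_norm_sq_mul_inner_pow [Nontrivial V] (y : V) (e l : ℕ) :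
    ∫ h : V, ‖h‖ ^ 2 * inner ℝ h y ^ (2 * e) *
        (‖y‖ ^ 2 - inner ℝ h y ^ 2 / ‖h‖ ^ 2) ^ l ∂(gaussMeasure V) =
      gammaRatio (1 / 2) e * gammaRatio (((Module.finrank ℝ V : ℝ) - 1) / 2) l *
        gammaRatio ((Module.finrank ℝ V : ℝ) / 2) (e + 1) /
        gammaRatio ((Module.finrank ℝ V : ℝ) / 2) (l + e) / Real.pi ^ (e + 1) *
        ‖y‖ ^ (2 * (l + e)) := by
  set N : ℝ := (Module.finrank ℝ V : ℝ) with hN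
  have hN0 : 0 < N := by
    rw [hN]
    exact_mod_cast Module.finrank_pos
  set Z : V → ℝ := fun h => (inner ℝ h y ^ 2 / ‖h‖ ^ 2) ^ e *
    (‖y‖ ^ 2 - inner ℝ h y ^ 2 / ‖h‖ ^ 2) ^ l with hZ
  have hhom : ∀ (c : ℝ) (v : V), 0 < c → Z (c • v) = Z v := by
    intro c v hc
    have : inner ℝ (c • v) y ^ 2 / ‖c • v‖ ^ 2 = inner ℝ v y ^ 2 / ‖v‖ ^ 2 := by
      rw [real_inner_smul_left, norm_smul, mul_pow, mul_pow, Real.norm_eq_abs, sq_abs,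
        mul_div_mul_left _ _ (by positivity)]
    simp only [hZ, this]
  have hdiv : ∀ h : V, inner ℝ h y ^ 2 / ‖h‖ ^ 2 * ‖h‖ ^ 2 = inner ℝ h y ^ 2 := by
    intro h
    by_cases h0 : h = 0
    · simp [h0]
    · have : ‖h‖ ≠ 0 := norm_ne_zero_iff.2 h0
      field_simp
  have hdivpow : ∀ h : V, inner ℝ h y ^ (2 * e) =
      (inner ℝ h y ^ 2 / ‖h‖ ^ 2) ^ e * ‖h‖ ^ (2 * e) := by
    intro h
    rw [pow_mul ‖h‖, ← mul_pow, hdiv, pow_mul]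
  have h1 : ∀ h : V, ‖h‖ ^ 2 * inner ℝ h y ^ (2 * e) *
        (‖y‖ ^ 2 - inner ℝ h y ^ 2 / ‖h‖ ^ 2) ^ l = Z h * ‖h‖ ^ (2 * (e + 1)) := by
    intro h
    rw [hdivpow h, hZ]
    ring
  have h2 : ∀ h : V, inner ℝ h y ^ (2 * e) * (‖h‖ ^ 2 * ‖y‖ ^ 2 - inner ℝ h y ^ 2) ^ l =
      Z h * ‖h‖ ^ (2 * (l + e)) := by
    intro h
    have : ‖h‖ ^ 2 * ‖y‖ ^ 2 - inner ℝ h y ^ 2 =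
        (‖y‖ ^ 2 - inner ℝ h y ^ 2 / ‖h‖ ^ 2) * ‖h‖ ^ 2 := by rw [sub_mul, hdiv]; ring
    rw [this, hdivpow h, hZ, mul_pow, ← pow_mul ‖h‖]
    ring
  have h3 := integral_inner_pow_mul_pow_gaussMeasure y e l
  simp only [h2] at h3
  rw [integral_mul_norm_pow_gaussMeasure hhom, integral_norm_pow_gaussMeasure, ← hN] at h3
  simp only [h1]
  rw [integral_mul_norm_pow_gaussMeasure hhom, integral_norm_pow_gaussMeasure, ← hN]
  have q1 := (gammaRatio_pos (half_pos hN0) (l + e)).ne'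
  have hp := Real.pi_ne_zero
  have q2 : Real.pi ^ (l + e) ≠ 0 := by positivity
  have q3 : Real.pi ^ (e + 1) ≠ 0 := by positivity
  rw [add_comm e l, mul_div_assoc', div_mul_eq_mul_div, div_left_inj' q2] at h3
  rw [mul_div_assoc', div_mul_eq_mul_div, div_left_inj' q3, div_mul_eq_mul_div, eq_div_iff q1]
  linear_combination gammaRatio (N / 2) (e + 1) * h3

variable (G : Submodule ℝ V)

/-- The inner product `⟨h, y⟩` is the sum of its parts in `G` and `Gᗮ`, which are independent;
in the binomial expansion of its even power, only the even powers of the parts contribute. -/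
theorem integral_norm_starProjection_sq_mul_inner_pow (hG : 0 < Module.finrank ℝ G) (y : V)
    (q l : ℕ) :
    ∫ h : V, ‖G.starProjection h‖ ^ 2 * inner ℝ h y ^ (2 * q) *
        (‖G.starProjection y‖ ^ 2 - inner ℝ (G.starProjection h) y ^ 2 /
          ‖G.starProjection h‖ ^ 2) ^ l ∂(gaussMeasure V) =
      (∑ e ∈ Finset.range (q + 1), (q.choose e : ℝ) * (gammaRatio (1 / 2) q *
          gammaRatio (((Module.finrank ℝ G : ℝ) - 1) / 2) l *
          gammaRatio ((Module.finrank ℝ G : ℝ) / 2) (e + 1) /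
          gammaRatio ((Module.finrank ℝ G : ℝ) / 2) (l + e) *
          ((‖G.starProjection y‖ ^ 2) ^ (l + e) *
            (‖y‖ ^ 2 - ‖G.starProjection y‖ ^ 2) ^ (q - e)))) / Real.pi ^ (q + 1) := by
  have : Nontrivial G := Module.finrank_pos_iff.1 hG
  set y1 : G := G.orthogonalProjectionOnto y with hy1
  set y2 : Gᗮ := Gᗮ.orthogonalProjectionOnto y with hy2
  have hn1 : ‖G.starProjection y‖ = ‖y1‖ := rfl
  have hn2 : ‖y‖ ^ 2 - ‖y1‖ ^ 2 = ‖y2‖ ^ 2 := by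
    have := Submodule.norm_sq_eq_add_norm_sq_starProjection y G
    rw [this]
    simp only [Submodule.starProjection_apply, ← hy1, ← hy2, Submodule.coe_norm]
    ring
  have hi1 : ∀ a : G, inner ℝ (a : V) y = inner ℝ a y1 := fun a => by
    rw [hy1, Submodule.inner_orthogonalProjectionOnto_eq_of_mem_left]
  have hi2 : ∀ b : Gᗮ, inner ℝ (b : V) y = inner ℝ b y2 := fun b => by
    rw [hy2, Submodule.inner_orthogonalProjectionOnto_eq_of_mem_left]
  have hP : ∀ p : G × Gᗮ, G.starProjection ((p.1 : V) + p.2) = p.1 := by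
    intro p
    rw [map_add, Submodule.starProjection_eq_self_iff.2 p.1.2,
      G.starProjection_apply_eq_zero_iff.2 p.2.2, add_zero]
  have hmeas : Measurable fun h : V => ‖G.starProjection h‖ ^ 2 * inner ℝ h y ^ (2 * q) *
        (‖G.starProjection y‖ ^ 2 - inner ℝ (G.starProjection h) y ^ 2 /
          ‖G.starProjection h‖ ^ 2) ^ l := by fun_prop
  rw [integral_gaussMeasure_eq_prod G hmeas, hn1, hn2]
  simp only [hP, inner_add_left, hi1, hi2, Submodule.coe_norm]
  have hexp : ∀ p : G × Gᗮ, ‖(p.1 : V)‖ ^ 2 * (inner ℝ p.1 y1 + inner ℝ p.2 y2) ^ (2 * q) *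
        (‖(y1 : V)‖ ^ 2 - inner ℝ p.1 y1 ^ 2 / ‖(p.1 : V)‖ ^ 2) ^ l =
      ∑ r ∈ Finset.range (2 * q + 1), ((2 * q).choose r : ℝ) *
        ((‖p.1‖ ^ 2 * inner ℝ p.1 y1 ^ r *
        (‖y1‖ ^ 2 - inner ℝ p.1 y1 ^ 2 / ‖p.1‖ ^ 2) ^ l) * inner ℝ p.2 y2 ^ (2 * q - r)) := by
    intro p
    rw [add_pow, Finset.mul_sum, Finset.sum_mul]
    refine Finset.sum_congr rfl fun r _ => ?_
    simp only [Submodule.coe_norm]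
    ring
  simp only [hexp]
  rw [integral_finsetSum _ fun r _ => ((integrable_norm_sq_mul_inner_pow y1 r l).mul_prod
    (integrable_inner_pow y2 (2 * q - r))).const_mul _]
  simp only [integral_const_mul]
  have hprod : ∀ r, ∫ p : G × Gᗮ, (‖p.1‖ ^ 2 * inner ℝ p.1 y1 ^ r *
        (‖y1‖ ^ 2 - inner ℝ p.1 y1 ^ 2 / ‖p.1‖ ^ 2) ^ l) * inner ℝ p.2 y2 ^ (2 * q - r)
          ∂((gaussMeasure G).prod (gaussMeasure Gᗮ)) =
      (∫ a : G, ‖a‖ ^ 2 * inner ℝ a y1 ^ r *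
        (‖y1‖ ^ 2 - inner ℝ a y1 ^ 2 / ‖a‖ ^ 2) ^ l ∂(gaussMeasure G)) *
      ∫ b : Gᗮ, inner ℝ b y2 ^ (2 * q - r) ∂(gaussMeasure Gᗮ) := fun r =>
    integral_prod_mul (fun a : G => ‖a‖ ^ 2 * inner ℝ a y1 ^ r *
        (‖y1‖ ^ 2 - inner ℝ a y1 ^ 2 / ‖a‖ ^ 2) ^ l) fun b : Gᗮ => inner ℝ b y2 ^ (2 * q - r)
  simp only [hprod]
  rw [sum_range_two_mul_of_odd_eq_zero q (fun r => ((2 * q).choose r : ℝ) *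
    ((∫ a : G, ‖a‖ ^ 2 * inner ℝ a y1 ^ r *
        (‖y1‖ ^ 2 - inner ℝ a y1 ^ 2 / ‖a‖ ^ 2) ^ l ∂(gaussMeasure G)) *
      ∫ b : Gᗮ, inner ℝ b y2 ^ (2 * q - r) ∂(gaussMeasure Gᗮ))), Finset.sum_div]
  · refine Finset.sum_congr rfl fun e he => ?_
    have he' : e ≤ q := by simpa [Nat.lt_succ_iff] using he
    rw [← Nat.mul_sub, integral_norm_sq_mul_inner_pow, integral_inner_pow_two_mul_gaussMeasure,
      show q + 1 = (e + 1) + (q - e) by omega, pow_add Real.pi]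
    have hc := choose_two_mul_mul_gammaRatio_half he'
    simp only [Submodule.coe_norm, pow_mul]
    linear_combination (gammaRatio (((Module.finrank ℝ G : ℝ) - 1) / 2) l *
          gammaRatio ((Module.finrank ℝ G : ℝ) / 2) (e + 1) /
          gammaRatio ((Module.finrank ℝ G : ℝ) / 2) (l + e) *
          ((‖(y1 : V)‖ ^ 2) ^ (l + e) * (‖(y2 : V)‖ ^ 2) ^ (q - e)) /
          (Real.pi ^ (e + 1) * Real.pi ^ (q - e))) * hc
  · intro e
    by_cases he : 2 * e + 1 ≤ 2 * q
    · rw [show 2 * q - (2 * e + 1) = 2 * (q - e - 1) + 1 by omega,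
        integral_inner_pow_odd_gaussMeasure, mul_zero, mul_zero]
    · rw [Nat.choose_eq_zero_of_lt (by omega), Nat.cast_zero, zero_mul]

/-- The integral formula for a random hyperplane `hᗮ` of `V`, where the direction of `h` is
uniformly distributed. The three factors are `[G, hᗮ]²` and the squared norms of the projections
of `y` to `hᗮ` and to `G ∩ hᗮ`. -/
theorem integral_hyperplane (hG : 0 < Module.finrank ℝ G) (y : V) (m l : ℕ) :
    ∫ h : V, ‖G.starProjection h‖ ^ 2 / ‖h‖ ^ 2 * (‖y‖ ^ 2 - inner ℝ h y ^ 2 / ‖h‖ ^ 2) ^ m *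
        (‖G.starProjection y‖ ^ 2 - inner ℝ (G.starProjection h) y ^ 2 /
          ‖G.starProjection h‖ ^ 2) ^ l ∂(gaussMeasure V) =
      (Module.finrank ℝ G : ℝ) / Module.finrank ℝ V *
        croftonPoly (Module.finrank ℝ V) (Module.finrank ℝ G - 1) 1 m l (‖y‖ ^ 2)
          (‖G.starProjection y‖ ^ 2) := by
  have hGV := Submodule.finrank_le G
  have hV : 0 < Module.finrank ℝ V := hG.trans_le hGV
  have : Nontrivial V := Module.finrank_pos_iff.1 hV
  set W : V → ℝ := fun h => (‖G.starProjection y‖ ^ 2 - inner ℝ (G.starProjection h) y ^ 2 /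
          ‖G.starProjection h‖ ^ 2) ^ l with hW
  set Z : ℕ → V → ℝ := fun q h => ‖G.starProjection h‖ ^ 2 / ‖h‖ ^ 2 *
    (inner ℝ h y ^ 2 / ‖h‖ ^ 2) ^ q * W h with hZ
  have hWbd : ∀ h, |W h| ≤ (‖G.starProjection y‖ ^ 2) ^ l := by
    intro h
    simp only [hW]
    rw [abs_pow]
    have h1 : inner ℝ (G.starProjection h) y = inner ℝ (G.starProjection h) (G.starProjection y) := by
      rw [← Submodule.inner_starProjection_left_eq_right,
        Submodule.starProjection_eq_self_iff.2 (Submodule.starProjection_apply_mem _ _)]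
    rw [h1]
    gcongr
    exact abs_norm_sq_sub_le _ _
  have hWhom : ∀ (c : ℝ) (v : V), 0 < c → W (c • v) = W v := by
    intro c v hc
    simp only [hW, map_smul]
    rw [real_inner_smul_left, norm_smul, mul_pow, mul_pow, Real.norm_eq_abs, sq_abs,
        mul_div_mul_left _ _ (by positivity)]
  have hZhom : ∀ q (c : ℝ) (v : V), 0 < c → Z q (c • v) = Z q v := by
    intro q c v hc
    simp only [hZ, hWhom c v hc, map_smul]
    rw [real_inner_smul_left, norm_smul, norm_smul, mul_pow, mul_pow, mul_pow, Real.norm_eq_abs,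
      sq_abs, mul_div_mul_left _ _ (by positivity), mul_div_mul_left _ _ (by positivity)]
  have hdiv : ∀ h : V, inner ℝ h y ^ 2 / ‖h‖ ^ 2 * ‖h‖ ^ 2 = inner ℝ h y ^ 2 := by
    intro h
    by_cases h0 : h = 0
    · simp [h0]
    · have : ‖h‖ ≠ 0 := norm_ne_zero_iff.2 h0
      field_simp
  have hdiv' : ∀ h : V, ‖G.starProjection h‖ ^ 2 / ‖h‖ ^ 2 * ‖h‖ ^ 2 = ‖G.starProjection h‖ ^ 2 := by
    intro h
    by_cases h0 : h = 0
    · simp [h0]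
    · have : ‖h‖ ≠ 0 := norm_ne_zero_iff.2 h0
      field_simp
  have hZint : ∀ q, Integrable (Z q) (gaussMeasure V) := by
    intro q
    have hm : Measurable (Z q) := by fun_prop
    refine integrable_gaussMeasure_of_le hm ((‖y‖ ^ 2) ^ q * (‖G.starProjection y‖ ^ 2) ^ l) 0
      fun v => ?_
    have h1 : ‖G.starProjection v‖ ^ 2 / ‖v‖ ^ 2 ≤ 1 := by
      refine div_le_one_of_le₀ ?_ (by positivity)
      gcongr
      exact Submodule.norm_starProjection_apply_le _ _
    simp only [hZ]
    rw [abs_mul, abs_of_nonneg (by positivity), pow_zero, mul_one]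
    calc _ ≤ 1 * (‖y‖ ^ 2) ^ q * (‖G.starProjection y‖ ^ 2) ^ l := by
          gcongr
          · exact inner_sq_div_norm_sq_le v y
          · exact hWbd v
      _ = _ := by ring
  have hexp : ∀ h : V, ‖G.starProjection h‖ ^ 2 / ‖h‖ ^ 2 *
      (‖y‖ ^ 2 - inner ℝ h y ^ 2 / ‖h‖ ^ 2) ^ m * W h =
      ∑ q ∈ Finset.range (m + 1), ((m.choose q : ℝ) * ((-1) ^ q * (‖y‖ ^ 2) ^ (m - q))) * Z q h := by
    intro h
    rw [sub_eq_neg_add, add_pow, Finset.mul_sum, Finset.sum_mul]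
    refine Finset.sum_congr rfl fun q _ => ?_
    rw [neg_pow, hZ]
    ring
  rw [integral_congr_ae (Eventually.of_forall hexp),
    integral_finsetSum _ fun q _ => (hZint q).const_mul _]
  simp only [integral_const_mul]
  -- `Z q` is homogeneous of degree zero, so the factor `‖h‖ ^ (2 * (q + 1))` that clears its
  -- denominators can be split off.
  have hZval : ∀ q, ∫ h, Z q h ∂(gaussMeasure V) =
      (∑ e ∈ Finset.range (q + 1), (q.choose e : ℝ) * (gammaRatio (1 / 2) q *
          gammaRatio (((Module.finrank ℝ G : ℝ) - 1) / 2) l *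
          gammaRatio ((Module.finrank ℝ G : ℝ) / 2) (e + 1) /
          gammaRatio ((Module.finrank ℝ G : ℝ) / 2) (l + e) *
          ((‖G.starProjection y‖ ^ 2) ^ (l + e) *
            (‖y‖ ^ 2 - ‖G.starProjection y‖ ^ 2) ^ (q - e)))) /
        gammaRatio ((Module.finrank ℝ V : ℝ) / 2) (q + 1) := by
    intro q
    have h1 := integral_norm_starProjection_sq_mul_inner_pow G hG y q l
    have h2 : ∀ h : V, ‖G.starProjection h‖ ^ 2 * inner ℝ h y ^ (2 * q) *
        (‖G.starProjection y‖ ^ 2 - inner ℝ (G.starProjection h) y ^ 2 /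
          ‖G.starProjection h‖ ^ 2) ^ l = Z q h * ‖h‖ ^ (2 * (q + 1)) := by
      intro h
      rw [pow_mul (inner ℝ h y), ← hdiv h]
      nth_rw 1 [← hdiv' h]
      simp only [hZ, hW]
      ring
    simp only [h2] at h1
    rw [integral_mul_norm_pow_gaussMeasure (hZhom q), integral_norm_pow_gaussMeasure] at h1
    have q2 : Real.pi ^ (q + 1) ≠ 0 := by
      have := Real.pi_pos
      positivity
    have q1 := (gammaRatio_pos (a := (Module.finrank ℝ V : ℝ) / 2) (by positivity) (q + 1)).ne'
    rw [mul_div_assoc', div_left_inj' q2] at h1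
    rw [eq_div_iff q1, h1]
  simp only [hZval]
  have := sum_choose_eq_croftonPoly_one (N := Module.finrank ℝ V) (g := Module.finrank ℝ G)
    (by exact_mod_cast hV) (by exact_mod_cast hG) m l (‖G.starProjection y‖ ^ 2)
    (‖y‖ ^ 2 - ‖G.starProjection y‖ ^ 2)
  rw [add_sub_cancel] at this
  rw [← this]
  refine Finset.sum_congr rfl fun q _ => ?_
  rw [mul_assoc]

end Hyperplane

/-! ### The weight `[F, L]²` as a determinant of projections -/

section Weight

variable {E : Type*} [NormedAddCommGroup E] [InnerProductSpace ℝ E] [FiniteDimensional ℝ E]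

/-- The determinant of `1 - p_{Lᗮ} p_{Fᗮ}`. It is a continuous function of `p_L`, it agrees with
`[F, L]²` if `F + L` is the whole space, and it vanishes otherwise. -/
noncomputable def projWeight (F L : Submodule ℝ E) : ℝ :=
  ContinuousLinearMap.det (1 - Lᗮ.starProjection * Fᗮ.starProjection)

theorem LinearMap.det_one_sub_mul_comm (A B : E →ₗ[ℝ] E) :
    LinearMap.det (1 - A * B) = LinearMap.det (1 - B * A) := by
  have b := Module.finBasis ℝ E
  rw [← LinearMap.det_toMatrix b, ← LinearMap.det_toMatrix b (1 - B * A), map_sub, map_sub,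
    LinearMap.toMatrix_one, LinearMap.toMatrix_mul, LinearMap.toMatrix_mul,
    Matrix.det_one_sub_mul_comm]

theorem det_ne_zero_iff_forall (A : E →L[ℝ] E) : A.det ≠ 0 ↔ ∀ x, A x = 0 → x = 0 := by
  rw [ContinuousLinearMap.det, Ne, LinearMap.det_eq_zero_iff_ker_ne_bot, not_not,
    LinearMap.ker_eq_bot']
  rfl

theorem projWeight_ne_zero_iff (F L : Submodule ℝ E) : projWeight F L ≠ 0 ↔ F ⊔ L = ⊤ := by
  rw [projWeight, det_ne_zero_iff_forall, ← Submodule.orthogonal_eq_bot_iff,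
    ← Submodule.inf_orthogonal, Submodule.eq_bot_iff]
  refine forall_congr' fun x => imp_congr_left ?_
  change x - Lᗮ.starProjection (Fᗮ.starProjection x) = 0 ↔ _
  rw [sub_eq_zero, Submodule.mem_inf]
  constructor
  · intro h
    have h1 : ‖x‖ ≤ ‖Fᗮ.starProjection x‖ := by
      nth_rw 1 [h]
      exact Submodule.norm_starProjection_apply_le _ _
    have h2 : x ∈ Fᗮ := by
      rw [Submodule.mem_iff_norm_starProjection]
      exact le_antisymm (Submodule.norm_starProjection_apply_le _ _) h1
    refine ⟨h2, ?_⟩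
    rw [h]
    exact Submodule.starProjection_apply_mem _ _
  · rintro ⟨h1, h2⟩
    rw [Submodule.starProjection_eq_self_iff.2 h1, Submodule.starProjection_eq_self_iff.2 h2]

theorem projWeight_top (F : Submodule ℝ E) : projWeight F ⊤ = 1 := by
  have h : (⊤ : Submodule ℝ E)ᗮ.starProjection = 0 := by
    rw [Submodule.starProjection_orthogonal, Submodule.starProjection_top, sub_self]
  rw [projWeight, h, zero_mul, sub_zero]
  exact LinearMap.det_id

theorem starProjection_inf_orthogonal_apply (K : Submodule ℝ E) (v x : E) :
    (K ⊓ (Submodule.span ℝ {v})ᗮ).starProjection x = K.starProjection x -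
      (inner ℝ (K.starProjection v) x / ‖K.starProjection v‖ ^ 2) • K.starProjection v := by
  set w := K.starProjection v with hw
  have hwK : w ∈ K := Submodule.starProjection_apply_mem _ _
  have hv : ∀ y ∈ K, inner ℝ v y = inner ℝ w y := fun y hy => by
    rw [hw, Submodule.inner_starProjection_left_eq_right,
      Submodule.starProjection_eq_self_iff.2 hy]
  refine Submodule.eq_starProjection_of_mem_of_inner_eq_zero ?_ ?_
  · have hmem : K.starProjection x - (inner ℝ w x / ‖w‖ ^ 2) • w ∈ K :=
      K.sub_mem (Submodule.starProjection_apply_mem _ _) (K.smul_mem _ hwK)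
    refine ⟨hmem, ?_⟩
    rw [SetLike.mem_coe, Submodule.mem_orthogonal_singleton_iff_inner_right, hv _ hmem,
      inner_sub_right, inner_smul_right, real_inner_self_eq_norm_sq,
      ← Submodule.inner_starProjection_left_eq_right, Submodule.starProjection_eq_self_iff.2 hwK]
    by_cases h0 : w = 0
    · simp [h0]
    · have : ‖w‖ ≠ 0 := norm_ne_zero_iff.2 h0
      field_simp
      ring
  · rintro y ⟨hyK, hyv⟩
    rw [SetLike.mem_coe, Submodule.mem_orthogonal_singleton_iff_inner_right, hv _ hyK] at hyv
    rw [sub_sub_eq_add_sub, add_sub_right_comm, inner_add_left,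
      Submodule.starProjection_inner_eq_zero _ _ hyK, real_inner_smul_left, hyv]
    simp

theorem norm_starProjection_inf_orthogonal_sq (K : Submodule ℝ E) (v x : E) :
    ‖(K ⊓ (Submodule.span ℝ {v})ᗮ).starProjection x‖ ^ 2 = ‖K.starProjection x‖ ^ 2 -
      inner ℝ (K.starProjection v) x ^ 2 / ‖K.starProjection v‖ ^ 2 := by
  have h : ∀ (M : Submodule ℝ E) (x : E), ‖M.starProjection x‖ ^ 2 =
      inner ℝ (M.starProjection x) x := by
    intro M x
    rw [← real_inner_self_eq_norm_sq, Submodule.inner_starProjection_left_eq_right,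
      Submodule.starProjection_eq_self_iff.2 (Submodule.starProjection_apply_mem _ _),
      Submodule.inner_starProjection_left_eq_right]
  rw [h, starProjection_inf_orthogonal_apply, inner_sub_left, ← h, real_inner_smul_left]
  ring

/-- Passing from `L` to the hyperplane `L ∩ vᗮ` of `L` multiplies the weight by the squared length
of the projection of `v / ‖v‖` to `F ∩ L`. -/
theorem projWeight_inf_orthogonal {F L : Submodule ℝ E} (h : projWeight F L ≠ 0) {v : E}
    (hvL : v ∈ L) (hv : v ≠ 0) :
    projWeight F (L ⊓ (Submodule.span ℝ {v})ᗮ) =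
      projWeight F L * (‖(F ⊓ L).starProjection v‖ ^ 2 / ‖v‖ ^ 2) := by
  set B : E →L[ℝ] E := 1 - Lᗮ.starProjection * Fᗮ.starProjection with hB
  have hBdet : B.det = projWeight F L := rfl
  have hBunit : IsUnit (B : E →ₗ[ℝ] E) := by
    rw [LinearMap.isUnit_iff_isUnit_det, isUnit_iff_ne_zero]
    exact h
  -- The solution `z` of `B z = v` satisfies `p_L z = v` and `p_F z = p_{F ∩ L} v`.
  obtain ⟨z, hz⟩ : ∃ z, B z = v := by
    have := (Module.End.isUnit_iff _).1 hBunit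
    exact this.2 v
  have hn : ‖v‖ ≠ 0 := norm_ne_zero_iff.2 hv
  have hPv : L.starProjection v = v := Submodule.starProjection_eq_self_iff.2 hvL
  have hz' : z - Lᗮ.starProjection (Fᗮ.starProjection z) = v := hz
  have hLz : L.starProjection z = v := by
    have := congrArg L.starProjection hz'
    rwa [map_sub, L.starProjection_apply_eq_zero_iff.2 (Submodule.starProjection_apply_mem _ _),
      sub_zero, hPv] at this
  have hFz : F.starProjection z ∈ F ⊓ L := by
    refine ⟨Submodule.starProjection_apply_mem _ _, ?_⟩
    have h1 : Lᗮ.starProjection z = z - v := by rw [Submodule.starProjection_orthogonal_val, hLz]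
    have h2 : Lᗮ.starProjection (F.starProjection z) = 0 := by
      have h3 : F.starProjection z = z - Fᗮ.starProjection z := by
        rw [Submodule.starProjection_orthogonal_val, sub_sub_cancel]
      rw [h3, map_sub, h1, ← hz']
      abel
    rwa [Submodule.starProjection_apply_eq_zero_iff, Submodule.orthogonal_orthogonal] at h2
  have hFLv : (F ⊓ L).starProjection v = F.starProjection z := by
    refine (Submodule.eq_starProjection_of_mem_of_inner_eq_zero hFz ?_)
    rintro y ⟨hyF, hyL⟩
    rw [inner_sub_left, Submodule.inner_starProjection_left_eq_right,
      Submodule.starProjection_eq_self_iff.2 hyF, ← hLz,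
      Submodule.inner_starProjection_left_eq_right, Submodule.starProjection_eq_self_iff.2 hyL,
      sub_self]
  have hval : ‖(F ⊓ L).starProjection v‖ ^ 2 = ‖v‖ ^ 2 - inner ℝ (Fᗮ.starProjection v) z := by
    have h1 : ‖(F ⊓ L).starProjection v‖ ^ 2 = inner ℝ ((F ⊓ L).starProjection v) v := by
      rw [← real_inner_self_eq_norm_sq, Submodule.inner_starProjection_left_eq_right,
        Submodule.starProjection_eq_self_iff.2 (Submodule.starProjection_apply_mem _ _),
        Submodule.inner_starProjection_left_eq_right]
    have h2 : inner ℝ z v = ‖v‖ ^ 2 := by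
      nth_rw 1 [← hPv]
      rw [← Submodule.inner_starProjection_left_eq_right, hLz, real_inner_self_eq_norm_sq]
    rw [h1, hFLv, Submodule.inner_starProjection_left_eq_right, real_inner_comm z,
      Submodule.starProjection_orthogonal_val, inner_sub_right, h2]
    ring
  have hperp : ∀ x, (L ⊓ (Submodule.span ℝ {v})ᗮ)ᗮ.starProjection x =
      Lᗮ.starProjection x + (inner ℝ v x / ‖v‖ ^ 2) • v := by
    intro x
    rw [Submodule.starProjection_orthogonal_val, Submodule.starProjection_orthogonal_val,
      starProjection_inf_orthogonal_apply, hPv]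
    abel
  -- Replacing `L` by `L ∩ vᗮ` changes `B` by a rank one operator with range spanned by `v = B z`,
  -- that is, by a transvection along `z` on the right.
  set f : Module.Dual ℝ E :=
    (-(1 / ‖v‖ ^ 2)) • (innerSL ℝ (Fᗮ.starProjection v) : E →ₗ[ℝ] ℝ) with hf
  have hfx : ∀ x, f x = -(inner ℝ (Fᗮ.starProjection v) x / ‖v‖ ^ 2) := by
    intro x
    change -(1 / ‖v‖ ^ 2) * inner ℝ (Fᗮ.starProjection v) x = _
    ring
  have hcomp : ((1 - (L ⊓ (Submodule.span ℝ {v})ᗮ)ᗮ.starProjection * Fᗮ.starProjection :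
      E →L[ℝ] E) : E →ₗ[ℝ] E) = (B : E →ₗ[ℝ] E) * LinearMap.transvection f z := by
    ext x
    change x - (L ⊓ (Submodule.span ℝ {v})ᗮ)ᗮ.starProjection (Fᗮ.starProjection x) =
      B (x + f x • z)
    rw [hperp, map_add, map_smul, hz]
    change _ = (x - Lᗮ.starProjection (Fᗮ.starProjection x)) + _
    rw [hfx, Submodule.inner_starProjection_left_eq_right, neg_smul]
    abel
  rw [projWeight, ContinuousLinearMap.det, hcomp, map_mul, LinearMap.transvection.det, hval,
    ← hBdet, ContinuousLinearMap.det]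
  rw [hfx]
  field_simp
  ring

theorem exists_abs_projWeight_le (E : Type*) [NormedAddCommGroup E] [InnerProductSpace ℝ E]
    [FiniteDimensional ℝ E] : ∃ C : ℝ, ∀ F L : Submodule ℝ E, |projWeight F L| ≤ C := by
  have : ProperSpace (E →L[ℝ] E) := FiniteDimensional.proper ℝ _
  obtain ⟨C, hC⟩ := (isCompact_closedBall (0 : E →L[ℝ] E) 2).exists_bound_of_continuousOn
    (f := fun A : E →L[ℝ] E => A.det) ContinuousLinearMap.continuous_det.continuousOn
  refine ⟨C, fun F L => hC _ ?_⟩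
  rw [mem_closedBall_zero_iff]
  calc _ ≤ ‖(1 : E →L[ℝ] E)‖ + ‖Lᗮ.starProjection * Fᗮ.starProjection‖ := norm_sub_le _ _
    _ ≤ 1 + 1 * 1 := by
      gcongr
      · exact ContinuousLinearMap.norm_id_le
      · refine (norm_mul_le _ _).trans ?_
        gcongr
        · exact Submodule.starProjection_norm_le _
        · exact Submodule.starProjection_norm_le _
    _ = 2 := by norm_num

/-- The Gram matrix `MᵀM` of the vectors has the same determinant as `MMᵀ`, which represents the sum
of the operators `x ↦ ⟨vᵢ, x⟩ vᵢ`. -/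
theorem det_gram_eq_det_sum_rankOne {ι : Type*} [Fintype ι] [DecidableEq ι] (v : ι → E)
    (hι : Fintype.card ι = Module.finrank ℝ E) :
    (Matrix.gram ℝ v).det =
      ContinuousLinearMap.det (∑ i, InnerProductSpace.rankOne ℝ (v i) (v i)) := by
  have e : Fin (Module.finrank ℝ E) ≃ ι := (Fintype.equivFinOfCardEq hι).symm
  have b := (stdOrthonormalBasis ℝ E).reindex e
  rw [Matrix.gram_eq_conjTranspose_mul b, Matrix.det_mul_comm, ContinuousLinearMap.det,
    ← LinearMap.det_toMatrix b.toBasis]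
  congr 1
  ext i j
  simp [LinearMap.toMatrix_apply, Matrix.mul_apply, InnerProductSpace.rankOne_apply,
    OrthonormalBasis.repr_apply_apply, mul_comm, real_inner_comm]

theorem starProjection_add_starProjection_inf_orthogonal {K F : Submodule ℝ E} (h : K ≤ F) :
    K.starProjection + (F ⊓ Kᗮ).starProjection = F.starProjection := by
  have hKF : ∀ y ∈ K, F.starProjection y = y ∧ K.starProjection y = y := fun y hy =>
    ⟨Submodule.starProjection_eq_self_iff.2 (h hy), Submodule.starProjection_eq_self_iff.2 hy⟩
  ext x
  have h1 : (F ⊓ Kᗮ).starProjection x = F.starProjection x - K.starProjection x := by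
    refine Submodule.eq_starProjection_of_mem_of_inner_eq_zero ⟨?_, ?_⟩ ?_
    · exact F.sub_mem (Submodule.starProjection_apply_mem _ _)
        (h (Submodule.starProjection_apply_mem _ _))
    · refine (Submodule.mem_orthogonal _ _).2 fun y hy => ?_
      rw [inner_sub_right, ← Submodule.inner_starProjection_left_eq_right,
        ← Submodule.inner_starProjection_left_eq_right, (hKF y hy).1, (hKF y hy).2, sub_self]
    · rintro w ⟨hwF, hwK⟩
      rw [sub_sub_eq_add_sub, add_sub_right_comm, inner_add_left,
        Submodule.starProjection_inner_eq_zero _ _ hwF,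
        K.inner_right_of_mem_orthogonal (Submodule.starProjection_apply_mem _ _) hwK, add_zero]
  rw [add_apply, h1]
  abel

/-- If `F + L` is the whole space, `p_F + p_L - p_{F ∩ L}` and `p_F + p_L - p_L p_F` have the same
determinant, because they differ by a unipotent factor. -/
theorem det_add_starProjection_eq_projWeight {F L : Submodule ℝ E} (h : F ⊔ L = ⊤) :
    ContinuousLinearMap.det (F.starProjection + (L ⊓ (F ⊓ L)ᗮ).starProjection) =
      projWeight F L := by
  set K := F ⊓ L with hK
  set pK := K.starProjection with hpK
  set F' := F ⊓ Kᗮ with hF'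
  set L' := L ⊓ Kᗮ with hL'
  have hF : pK + F'.starProjection = F.starProjection :=
    starProjection_add_starProjection_inf_orthogonal inf_le_left
  have hL : pK + L'.starProjection = L.starProjection :=
    starProjection_add_starProjection_inf_orthogonal inf_le_right
  set S : E →L[ℝ] E := F.starProjection + L'.starProjection with hS
  have hSinj : ∀ x, S x = 0 → x = 0 := by
    intro x hx
    have h1 : ‖F.starProjection x‖ ^ 2 + ‖L'.starProjection x‖ ^ 2 = 0 := by
      have h2 : ∀ M : Submodule ℝ E, ‖M.starProjection x‖ ^ 2 = inner ℝ (M.starProjection x) x := by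
        intro M
        rw [← real_inner_self_eq_norm_sq, Submodule.inner_starProjection_left_eq_right,
          Submodule.starProjection_eq_self_iff.2 (Submodule.starProjection_apply_mem _ _),
          Submodule.inner_starProjection_left_eq_right]
      rw [h2, h2, ← inner_add_left]
      change inner ℝ (S x) x = 0
      rw [hx, inner_zero_left]
    have h3 : F.starProjection x = 0 := by
      rw [← norm_eq_zero, ← sq_eq_zero_iff]
      nlinarith [sq_nonneg ‖F.starProjection x‖, sq_nonneg ‖L'.starProjection x‖]
    have h4 : L'.starProjection x = 0 := by
      rw [← norm_eq_zero, ← sq_eq_zero_iff]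
      nlinarith [sq_nonneg ‖F.starProjection x‖, sq_nonneg ‖L'.starProjection x‖]
    have h5 : x ∈ Fᗮ := (Submodule.starProjection_apply_eq_zero_iff F).1 h3
    have h6 : pK x = 0 := (Submodule.starProjection_apply_eq_zero_iff K).2
      (Submodule.orthogonal_le inf_le_left h5)
    have h7 : x ∈ Lᗮ := by
      rw [← Submodule.starProjection_apply_eq_zero_iff L, ← hL, add_apply, h4, h6, add_zero]
    have h8 : x ∈ (F ⊔ L)ᗮ := by
      rw [← Submodule.inf_orthogonal]
      exact ⟨h5, h7⟩
    rw [h, Submodule.top_orthogonal_eq_bot] at h8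
    exact h8
  have hSunit : IsUnit (S : E →ₗ[ℝ] E) := by
    rw [LinearMap.isUnit_iff_isUnit_det, isUnit_iff_ne_zero]
    exact (det_ne_zero_iff_forall S).2 hSinj
  obtain ⟨T, hT1, hT2⟩ := isUnit_iff_exists.1 hSunit
  have hzero : ((F'.starProjection : E →ₗ[ℝ] E) * T) * (L'.starProjection : E →ₗ[ℝ] E) = 0 := by
    ext x
    set y := L'.starProjection x with hy
    set s := T y with hs
    change F'.starProjection s = 0
    have hSs : S s = y := congrArg (fun A : E →ₗ[ℝ] E => A y) hT1
    have e1 : F'.starProjection s = y - L.starProjection s := by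
      rw [← hSs, hS, ← hF, ← hL]
      simp only [add_apply]
      abel
    have m1 : F'.starProjection s ∈ F' := Submodule.starProjection_apply_mem _ _
    have m2 : F'.starProjection s ∈ L := by
      rw [e1]
      exact L.sub_mem (Submodule.starProjection_apply_mem L' x).1
        (Submodule.starProjection_apply_mem _ _)
    have m3 : F'.starProjection s ∈ K ⊓ Kᗮ := ⟨⟨m1.1, m2⟩, m1.2⟩
    rwa [Submodule.inf_orthogonal_eq_bot] at m3
  -- `hzero` says that the subtracted operator below has square zero.
  have hR : ((1 - Lᗮ.starProjection * Fᗮ.starProjection : E →L[ℝ] E) : E →ₗ[ℝ] E) =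
      (1 - (L'.starProjection : E →ₗ[ℝ] E) * ((F'.starProjection : E →ₗ[ℝ] E) * T)) *
        (S : E →ₗ[ℝ] E) := by
    rw [sub_mul, mul_assoc, mul_assoc, hT2, mul_one, one_mul]
    ext x
    change x - Lᗮ.starProjection (Fᗮ.starProjection x) =
      S x - L'.starProjection (F'.starProjection x)
    have e1 : pK (F'.starProjection x) = 0 := (Submodule.starProjection_apply_eq_zero_iff K).2
      (Submodule.starProjection_apply_mem F' x).2
    have e2 : L'.starProjection (pK x) = 0 := by
      refine (Submodule.starProjection_apply_eq_zero_iff L').2 ?_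
      refine (Submodule.mem_orthogonal _ _).2 fun u hu => ?_
      exact K.inner_left_of_mem_orthogonal (Submodule.starProjection_apply_mem _ _) hu.2
    have e3 : pK (pK x) = pK x :=
      Submodule.starProjection_eq_self_iff.2 (Submodule.starProjection_apply_mem _ _)
    rw [Submodule.starProjection_orthogonal_val, Submodule.starProjection_orthogonal_val, hS,
      ← hF, ← hL]
    simp only [add_apply, map_add, map_sub, e1, e2, e3]
    abel
  rw [projWeight, ContinuousLinearMap.det, ContinuousLinearMap.det, hR, map_mul,
    LinearMap.det_one_sub_mul_comm, hzero, sub_zero, map_one, one_mul]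

end Weight

/-- The spanning vectors in the definition of `[F, L]` are orthonormal bases of `F ∩ L`,
`F ∩ (F ∩ L)ᗮ` and `L ∩ (F ∩ L)ᗮ`, so their Gram determinant is that of the sum of the projections
to these subspaces. The hypothesis makes their number equal to the dimension. -/
theorem subspaceDet_sq {n : ℕ} {F L : Submodule ℝ (Eucl n)} (h : F ⊔ L = ⊤) :
    subspaceDet F L ^ 2 = projWeight F L := by
  rw [subspaceDet, parallelepipedVolume, Real.sq_sqrt (Matrix.posSemidef_gram ℝ _).det_nonneg,
    det_gram_eq_det_sum_rankOne, ← det_add_starProjection_eq_projWeight h,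
    ← starProjection_add_starProjection_inf_orthogonal (inf_le_left : F ⊓ L ≤ F)]
  · congr 1
    rw [Fintype.sum_sum_type, Fintype.sum_sum_type]
    simp only [Sum.elim_inl, Sum.elim_inr]
    rw [← OrthonormalBasis.starProjection_eq_sum_rankOne,
      ← OrthonormalBasis.starProjection_eq_sum_rankOne,
      ← OrthonormalBasis.starProjection_eq_sum_rankOne, add_assoc]
  · have h1 := Submodule.finrank_add_inf_finrank_orthogonal (inf_le_left : F ⊓ L ≤ F)
    have h2 := Submodule.finrank_add_inf_finrank_orthogonal (inf_le_right : F ⊓ L ≤ L)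
    have h3 := Submodule.finrank_sup_add_finrank_inf_eq F L
    rw [h, finrank_top] at h3
    rw [inf_comm (F ⊓ L)ᗮ] at h1 h2
    simp only [Fintype.card_sum, Fintype.card_fin]
    omega

/-! ### Random subspaces of codimension one in a random subspace -/

theorem OrthGroup.inner_map_map {n : ℕ} (A : OrthGroup n) (x y : Eucl n) :
    inner ℝ (Matrix.toEuclideanLin A.1 x) (Matrix.toEuclideanLin A.1 y) = inner ℝ x y := by
  change inner ℝ (Matrix.toEuclideanCLM (n := Fin n) (𝕜 := ℝ) A.1 x)
    (Matrix.toEuclideanCLM (n := Fin n) (𝕜 := ℝ) A.1 y) = _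
  rw [← ContinuousLinearMap.adjoint_inner_left, ← ContinuousLinearMap.star_eq_adjoint, ← map_star]
  congr 1
  have h : Matrix.toEuclideanCLM (n := Fin n) (𝕜 := ℝ) (star A.1) *
      Matrix.toEuclideanCLM (n := Fin n) (𝕜 := ℝ) A.1 = 1 := by
    rw [← map_mul, (Unitary.mem_iff.1 A.2).1, map_one]
  exact congrArg (fun B : Eucl n →L[ℝ] Eucl n => B x) h

/-- The linear isometry defined by an orthogonal matrix. -/
noncomputable def OrthGroup.toIsometry {n : ℕ} (A : OrthGroup n) : Eucl n →ₗᵢ[ℝ] Eucl n :=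
  (Matrix.toEuclideanLin A.1).isometryOfInner A.inner_map_map

theorem OrthGroup.act_space {n d : ℕ} (A : OrthGroup n) (L : Grassmannian n d) :
    (A.act L).space = L.space.map A.toIsometry.toLinearMap := rfl

theorem OrthGroup.mul_act {n d : ℕ} (A B : OrthGroup n) (L : Grassmannian n d) :
    (A * B).act L = A.act (B.act L) := by
  refine Subtype.ext ?_
  change Submodule.map _ _ = Submodule.map _ (Submodule.map _ _)
  rw [← Submodule.map_comp]
  congr 1
  ext x
  simp [Matrix.toEuclideanLin, Matrix.toLpLin_apply, Matrix.mulVec_mulVec]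

/-- The orthogonal group acts transitively on the Grassmannian. -/
theorem OrthGroup.exists_act_eq {n d : ℕ} (X Y : Grassmannian n d) :
    ∃ B : OrthGroup n, B.act X = Y := by
  have e : X.space ≃ₗᵢ[ℝ] Y.space :=
    (stdOrthonormalBasis ℝ X.space).equiv (stdOrthonormalBasis ℝ Y.space)
      (finCongr (X.2.trans Y.2.symm))
  set T : Eucl n →ₗᵢ[ℝ] Eucl n := (Y.space.subtypeₗᵢ.comp e.toLinearIsometry).extend with hT
  have hTX : ∀ x : X.space, T x = e x := fun x => LinearIsometry.extend_apply _ x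
  set M : Matrix (Fin n) (Fin n) ℝ :=
    (Matrix.toEuclideanCLM (n := Fin n) (𝕜 := ℝ)).symm T.toContinuousLinearMap with hM
  have hMT : Matrix.toEuclideanCLM (n := Fin n) (𝕜 := ℝ) M = T.toContinuousLinearMap :=
    (Matrix.toEuclideanCLM (n := Fin n) (𝕜 := ℝ)).apply_symm_apply _
  have hstar : star M * M = 1 := by
    apply EquivLike.injective (Matrix.toEuclideanCLM (n := Fin n) (𝕜 := ℝ))
    rw [map_mul, map_star, hMT, map_one, ContinuousLinearMap.star_eq_adjoint]
    exact (ContinuousLinearMap.norm_map_iff_adjoint_comp_self _).1 T.norm_map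
  refine ⟨⟨M, Matrix.mem_unitaryGroup_iff'.2 hstar⟩, Subtype.ext ?_⟩
  change Submodule.map (Matrix.toEuclideanLin M) X.space = Y.space
  have hMx : ∀ x, Matrix.toEuclideanLin M x = T x := fun x =>
    congrArg (fun B : Eucl n →L[ℝ] Eucl n => B x) hMT
  ext y
  constructor
  · rintro ⟨x, hx, rfl⟩
    rw [hMx, hTX ⟨x, hx⟩]
    exact (e ⟨x, hx⟩).2
  · intro hy
    refine ⟨e.symm ⟨y, hy⟩, (e.symm ⟨y, hy⟩).2, ?_⟩
    rw [hMx, hTX, e.apply_symm_apply]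

/-- A left Haar measure on a compact group is right invariant. -/
theorem OrthGroup.map_mul_right_haar {n : ℕ} (B : OrthGroup n) :
    (OrthGroup.haar n).map (fun A => A * B) = OrthGroup.haar n := by
  have : (OrthGroup.haar n).IsHaarMeasure := by unfold OrthGroup.haar; infer_instance
  have hp : IsProbabilityMeasure ((OrthGroup.haar n).map (fun A => A * B)) :=
    Measure.isProbabilityMeasure_map (continuous_mul_const B).measurable.aemeasurable
  have h2 : ((OrthGroup.haar n).map (fun A => A * B)).IsHaarMeasure := inferInstance
  exact Measure.isHaarMeasure_eq_of_isProbabilityMeasure _ _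

/-- A random rotation of an arbitrary fixed subspace has the distribution `ν_d`. -/
theorem Grassmannian.map_act_haar {n d : ℕ} (h : d ≤ n) (X : Grassmannian n d) :
    (OrthGroup.haar n).map (fun A => A.act X) = Grassmannian.nu n d h := by
  obtain ⟨B, rfl⟩ := OrthGroup.exists_act_eq (Grassmannian.coord n d h) X
  have e : (fun A : OrthGroup n => A.act (B.act (Grassmannian.coord n d h))) =
      (fun A => A.act (Grassmannian.coord n d h)) ∘ fun A => A * B := by
    funext A
    exact (OrthGroup.mul_act A B _).symm
  rw [e, ← Measure.map_map (OrthGroup.continuous_act _).measurable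
    (continuous_mul_const B).measurable, OrthGroup.map_mul_right_haar, Grassmannian.nu]

theorem Grassmannian.measurable_of_starProjection {n d : ℕ} {α : Type*} [MeasurableSpace α]
    {g : α → Grassmannian n d} (hg : Measurable fun a => (g a).space.starProjection) :
    Measurable g := by
  have h : Grassmannian.instMeasurableSpace n d =
      MeasurableSpace.comap (fun L : Grassmannian n d => L.space.starProjection) (borel _) :=
    borel_comap (f := fun L : Grassmannian n d => L.space.starProjection)
  rw [h]
  exact measurable_comap_iff.2 hg

theorem Grassmannian.continuous_starProjection (n d : ℕ) :
    Continuous fun L : Grassmannian n d => L.space.starProjection := continuous_induced_dom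

theorem Submodule.starProjection_congr {E : Type*} [NormedAddCommGroup E] [InnerProductSpace ℝ E]
    [FiniteDimensional ℝ E] {K L : Submodule ℝ E} (h : K = L) :
    K.starProjection = L.starProjection := by
  subst h
  rfl

theorem Submodule.finrank_inf_orthogonal_singleton {E : Type*} [NormedAddCommGroup E]
    [InnerProductSpace ℝ E] [FiniteDimensional ℝ E] {K : Submodule ℝ E} {d : ℕ}
    (hK : Module.finrank ℝ K = d + 1) {v : E} (hv : v ∈ K) (hv0 : v ≠ 0) :
    Module.finrank ℝ ↥(K ⊓ (Submodule.span ℝ {v})ᗮ) = d := by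
  have h1 : Submodule.span ℝ {v} ≤ K := by
    rwa [Submodule.span_singleton_le_iff_mem]
  have h2 := Submodule.finrank_add_inf_finrank_orthogonal h1
  rw [finrank_span_singleton hv0, hK, inf_comm] at h2
  omega

open Classical in
/-- The hyperplane of `C` orthogonal to `h`, for a nonzero vector `h` of `C`. For `h = 0` the
arbitrary value `X` is assigned. -/
noncomputable def Grassmannian.hyperplane {n d : ℕ} (C : Grassmannian n (d + 1))
    (X : Grassmannian n d) (h : C.space) : Grassmannian n d :=
  ⟨if h = 0 then X.space else C.space ⊓ (Submodule.span ℝ {(h : Eucl n)})ᗮ, by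
    by_cases hh : h = 0
    · rw [if_pos hh]
      exact X.2
    · rw [if_neg hh]
      exact Submodule.finrank_inf_orthogonal_singleton C.2 h.2 (by simpa using hh)⟩

theorem Grassmannian.hyperplane_space {n d : ℕ} (C : Grassmannian n (d + 1))
    (X : Grassmannian n d) {h : C.space} (hh : h ≠ 0) :
    (C.hyperplane X h).space = C.space ⊓ (Submodule.span ℝ {(h : Eucl n)})ᗮ :=
  if_neg hh

theorem Grassmannian.measurable_act_hyperplane {n d : ℕ} (C : Grassmannian n (d + 1))
    (X : Grassmannian n d) :
    Measurable fun p : OrthGroup n × C.space => p.1.act (C.hyperplane X p.2) := by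
  classical
  refine Grassmannian.measurable_of_starProjection ?_
  have h1 : Measurable fun h : C.space => (C.hyperplane X h).space.starProjection := by
    have e : (fun h : C.space => (C.hyperplane X h).space.starProjection) = fun h : C.space =>
        if h = 0 then X.space.starProjection else C.space.starProjection -
          (‖(h : Eucl n)‖ ^ 2)⁻¹ • (innerSL ℝ (h : Eucl n)).smulRight (h : Eucl n) := by
      funext h
      split_ifs with hh
      · exact Submodule.starProjection_congr (if_pos hh)
      · rw [hyperplane_space C X hh]
        ext1 x
        rw [starProjection_inf_orthogonal_apply, Submodule.starProjection_eq_self_iff.2 h.2]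
        simp only [sub_apply, smul_apply, ContinuousLinearMap.smulRight_apply, innerSL_apply_apply,
          smul_smul]
        rw [div_eq_inv_mul]
    rw [e]
    refine Measurable.ite (measurableSet_singleton 0) measurable_const ?_
    refine measurable_const.sub (Measurable.smul
      ((measurable_subtype_coe.norm.pow_const 2).inv) ?_)
    have : Continuous fun v : Eucl n => (innerSL ℝ v).smulRight v := by
      fun_prop
    exact this.measurable.comp measurable_subtype_coe
  have hC : Continuous fun B : Matrix (Fin n) (Fin n) ℝ =>
      Matrix.toEuclideanCLM (n := Fin n) (𝕜 := ℝ) B :=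
    LinearMap.continuous_of_finiteDimensional
      (Matrix.toEuclideanCLM (n := Fin n) (𝕜 := ℝ)).toAlgEquiv.toLinearMap
  have hcomp : Measurable fun q : (Eucl n →L[ℝ] Eucl n) × (Eucl n →L[ℝ] Eucl n) => q.1 ∘L q.2 :=
    (continuous_fst.clm_comp continuous_snd).measurable
  have h2 : Measurable fun A : OrthGroup n => Matrix.toEuclideanCLM (n := Fin n) (𝕜 := ℝ) A.1 :=
    (hC.comp continuous_subtype_val).measurable
  have h3 : Measurable fun A : OrthGroup n =>
      Matrix.toEuclideanCLM (n := Fin n) (𝕜 := ℝ) (star A.1) :=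
    (hC.comp continuous_subtype_val.star).measurable
  simp only [OrthGroup.starProjection_act]
  exact hcomp.comp ((h2.comp measurable_fst).prodMk
    (hcomp.comp ((h1.comp measurable_snd).prodMk (h3.comp measurable_fst))))

/-- A random subspace of dimension `d` may be generated by choosing a random subspace of dimension
`d + 1` and in it the hyperplane orthogonal to a Gaussian random vector. -/
theorem Grassmannian.nu_eq_map_hyperplane {n d : ℕ} (h : d ≤ n) (C : Grassmannian n (d + 1))
    (X : Grassmannian n d) :
    Grassmannian.nu n d h = ((OrthGroup.haar n).prod (gaussMeasure C.space)).map
      fun p => p.1.act (C.hyperplane X p.2) := by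
  ext s hs
  have hm := Grassmannian.measurable_act_hyperplane C X
  rw [Measure.map_apply hm hs, Measure.prod_apply_symm (hm hs)]
  have : ∀ v : C.space, OrthGroup.haar n ((fun A => (A, v)) ⁻¹'
      ((fun p : OrthGroup n × C.space => p.1.act (C.hyperplane X p.2)) ⁻¹' s)) =
        Grassmannian.nu n d h s := by
    intro v
    rw [← Grassmannian.map_act_haar h (C.hyperplane X v),
      Measure.map_apply (OrthGroup.continuous_act _).measurable hs]
    rfl
  simp [this]

/-- The projection to `F ∩ L` is measurable, being a limit of averages of powers of `p_F p_L` by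
the mean ergodic theorem. -/
theorem Grassmannian.measurable_starProjection_inf {n d : ℕ} (F : Submodule ℝ (Eucl n))
    (x : Eucl n) :
    Measurable fun L : Grassmannian n d => (F ⊓ L.space).starProjection x := by
  have hfix : ∀ L : Submodule ℝ (Eucl n),
      (F.starProjection * L.starProjection).eqLocus (1 : Eucl n →L[ℝ] Eucl n) = F ⊓ L := by
    intro L
    ext y
    change F.starProjection (L.starProjection y) = y ↔ _
    constructor
    · intro h
      have h1 : ‖y‖ ≤ ‖L.starProjection y‖ := by
        nth_rw 1 [← h]
        exact Submodule.norm_starProjection_apply_le _ _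
      refine ⟨?_, ?_⟩
      · rw [← h]
        exact Submodule.starProjection_apply_mem _ _
      · rw [SetLike.mem_coe, Submodule.mem_iff_norm_starProjection]
        exact le_antisymm (Submodule.norm_starProjection_apply_le _ _) h1
    · rintro ⟨h1, h2⟩
      rw [Submodule.starProjection_eq_self_iff.2 h2, Submodule.starProjection_eq_self_iff.2 h1]
  have hlim : ∀ L : Grassmannian n d, Tendsto
      (fun N => birkhoffAverage ℝ (F.starProjection * L.space.starProjection) _root_.id N x)
      atTop (𝓝 ((F ⊓ L.space).starProjection x)) := by
    intro L
    have h := ContinuousLinearMap.tendsto_birkhoffAverage_orthogonalProjection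
      (F.starProjection * L.space.starProjection) ((norm_mul_le _ _).trans
        (mul_le_one₀ (Submodule.starProjection_norm_le _) (norm_nonneg _)
          (Submodule.starProjection_norm_le _))) x
    rw [← Submodule.starProjection_congr (hfix L.space)]
    exact h
  refine measurable_of_tendsto_metrizable (f := fun N (L : Grassmannian n d) =>
    birkhoffAverage ℝ (F.starProjection * L.space.starProjection) _root_.id N x) (fun N => ?_)
    (tendsto_pi_nhds.2 hlim)
  have hiter : ∀ k : ℕ, Continuous fun L : Grassmannian n d =>
      (F.starProjection * L.space.starProjection)^[k] x := by
    intro k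
    induction k with
    | zero => exact continuous_const
    | succ k ih =>
      simp only [Function.iterate_succ_apply']
      exact (continuous_const.mul (Grassmannian.continuous_starProjection n d)).clm_apply ih
  simp only [birkhoffAverage, birkhoffSum, id]
  exact ((continuous_finsetSum _ fun k _ => hiter k).const_smul (N : ℝ)⁻¹).measurable

theorem Grassmannian.continuous_projWeight {n d : ℕ} (F : Submodule ℝ (Eucl n)) :
    Continuous fun L : Grassmannian n d => projWeight F L.space := by
  have e : (fun L : Grassmannian n d => projWeight F L.space) = fun L => ContinuousLinearMap.det
      (1 - (1 - L.space.starProjection) * Fᗮ.starProjection) := by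
    funext L
    rw [projWeight, Submodule.starProjection_orthogonal' L.space]
  rw [e]
  exact ContinuousLinearMap.continuous_det.comp (continuous_const.sub
    ((continuous_const.sub (Grassmannian.continuous_starProjection n d)).mul continuous_const))

/-- The integrand, evaluated at a vector `x`, with `[F, L]²` replaced by `projWeight F L`. -/
noncomputable def croftonIntegrand {n : ℕ} (F : Submodule ℝ (Eucl n)) (m l : ℕ) (x : Eucl n)
    (L : Submodule ℝ (Eucl n)) : ℝ :=
  projWeight F L * ((‖L.starProjection x‖ ^ 2) ^ m * (‖(F ⊓ L).starProjection x‖ ^ 2) ^ l)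

theorem measurable_croftonIntegrand {n d : ℕ} (F : Submodule ℝ (Eucl n)) (m l : ℕ) (x : Eucl n) :
    Measurable fun L : Grassmannian n d => croftonIntegrand F m l x L.space := by
  refine (Grassmannian.continuous_projWeight F).measurable.mul (Measurable.mul ?_ ?_)
  · have h : Continuous fun L : Grassmannian n d => L.space.starProjection x :=
      (Grassmannian.continuous_starProjection n d).clm_apply continuous_const
    exact (h.norm.pow 2 |>.pow m).measurable
  · exact (((Grassmannian.measurable_starProjection_inf F x).norm.pow_const 2).pow_const l)

theorem exists_abs_croftonIntegrand_le {n : ℕ} (F : Submodule ℝ (Eucl n)) (m l : ℕ) (x : Eucl n) :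
    ∃ C : ℝ, ∀ L, |croftonIntegrand F m l x L| ≤ C := by
  obtain ⟨C, hC⟩ := exists_abs_projWeight_le (Eucl n)
  refine ⟨C * ((‖x‖ ^ 2) ^ m * (‖x‖ ^ 2) ^ l), fun L => ?_⟩
  have hC0 : 0 ≤ C := (abs_nonneg _).trans (hC F L)
  rw [croftonIntegrand, abs_mul, abs_of_nonneg (a := _ ^ m * _) (by positivity)]
  gcongr
  · exact hC F L
  · exact Submodule.norm_starProjection_apply_le _ _
  · exact Submodule.norm_starProjection_apply_le _ _

theorem integrable_croftonIntegrand {n d : ℕ} (h : d ≤ n) (F : Submodule ℝ (Eucl n)) (m l : ℕ)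
    (x : Eucl n) :
    Integrable (fun L : Grassmannian n d => croftonIntegrand F m l x L.space)
      (Grassmannian.nu n d h) := by
  obtain ⟨C, hC⟩ := exists_abs_croftonIntegrand_le F m l x
  exact Integrable.of_bound (measurable_croftonIntegrand F m l x).aestronglyMeasurable C
    (Eventually.of_forall fun L => hC L.space)

/-! ### The scalar integral formula -/

theorem LinearIsometry.starProjection_map {V E : Type*} [NormedAddCommGroup V]
    [InnerProductSpace ℝ V] [FiniteDimensional ℝ V] [NormedAddCommGroup E] [InnerProductSpace ℝ E]
    [FiniteDimensional ℝ E] (T : V →ₗᵢ[ℝ] E) {K : Submodule ℝ E}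
    (hK : K ≤ LinearMap.range T.toLinearMap) (h : V) :
    K.starProjection (T h) = T ((K.comap T.toLinearMap).starProjection h) := by
  have e : (K.comap T.toLinearMap).map T.toLinearMap = K := by
    rw [Submodule.map_comap_eq, inf_eq_right.2 hK]
  rw [← Submodule.starProjection_congr e]
  symm
  exact T.map_starProjection _ _

section Step

variable {n d : ℕ}

/-- The isometric embedding of `C` onto the rotated subspace `A C`. -/
noncomputable def OrthGroup.embed (A : OrthGroup n) (C : Grassmannian n d) :
    C.space →ₗᵢ[ℝ] Eucl n := A.toIsometry.comp C.space.subtypeₗᵢ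

theorem OrthGroup.range_embed (A : OrthGroup n) (C : Grassmannian n d) :
    LinearMap.range (A.embed C).toLinearMap = (A.act C).space := by
  rw [OrthGroup.act_space]
  ext y
  constructor
  · rintro ⟨x, rfl⟩
    exact ⟨x, x.2, rfl⟩
  · rintro ⟨x, hx, rfl⟩
    exact ⟨⟨x, hx⟩, rfl⟩

theorem OrthGroup.embed_mem (A : OrthGroup n) (C : Grassmannian n d) (h : C.space) :
    A.embed C h ∈ (A.act C).space := by
  rw [← A.range_embed C]
  exact ⟨h, rfl⟩

theorem OrthGroup.act_hyperplane_space (A : OrthGroup n) (C : Grassmannian n (d + 1))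
    (X : Grassmannian n d) {h : C.space} (hh : h ≠ 0) :
    (A.act (C.hyperplane X h)).space =
      (A.act C).space ⊓ (Submodule.span ℝ {A.embed C h})ᗮ := by
  rw [OrthGroup.act_space, OrthGroup.act_space, C.hyperplane_space X hh,
    Submodule.map_inf _ A.toIsometry.injective]
  have key : ∀ x : Eucl n, inner ℝ (A.embed C h) (A.toIsometry x) = inner ℝ (h : Eucl n) x :=
    fun x => A.toIsometry.inner_map_map _ _
  ext y
  simp only [Submodule.mem_inf, Submodule.mem_map,
    Submodule.mem_orthogonal_singleton_iff_inner_right]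
  constructor
  · rintro ⟨h1, x, hx, rfl⟩
    exact ⟨h1, (key x).trans hx⟩
  · rintro ⟨⟨x, hx, rfl⟩, h2⟩
    exact ⟨⟨x, hx, rfl⟩, x, (key x).symm.trans h2, rfl⟩

theorem projWeight_act_hyperplane (F : Submodule ℝ (Eucl n)) (A : OrthGroup n)
    (C : Grassmannian n (d + 1)) (X : Grassmannian n d)
    (hW : projWeight F (A.act C).space ≠ 0) {h : C.space} (hh : h ≠ 0) :
    projWeight F (A.act (C.hyperplane X h)).space = projWeight F (A.act C).space *
      (‖((F ⊓ (A.act C).space).comap (A.embed C).toLinearMap).starProjection h‖ ^ 2 / ‖h‖ ^ 2) := by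
  have hle : F ⊓ (A.act C).space ≤ LinearMap.range (A.embed C).toLinearMap := by
    rw [A.range_embed C]
    exact inf_le_right
  rw [A.act_hyperplane_space C X hh, projWeight_inf_orthogonal hW (A.embed_mem C h)
    (by rwa [Ne, ← map_zero (A.embed C), (A.embed C).injective.eq_iff]),
    LinearIsometry.starProjection_map _ hle, LinearIsometry.norm_map, LinearIsometry.norm_map]

/-- The integrand for a random hyperplane of `A C`, written in the fixed space `C`, where `y` stands
for the projection of `x` and `G` for `F ∩ A C`. -/
theorem croftonIntegrand_act_hyperplane (F : Submodule ℝ (Eucl n)) (A : OrthGroup n)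
    (C : Grassmannian n (d + 1)) (X : Grassmannian n d)
    (hW : projWeight F (A.act C).space ≠ 0) (m l : ℕ) (x : Eucl n) {y : C.space}
    (hy : A.embed C y = (A.act C).space.starProjection x) {h : C.space} (hh : h ≠ 0)
    (G : Submodule ℝ C.space) (hG : G = (F ⊓ (A.act C).space).comap (A.embed C).toLinearMap) :
    croftonIntegrand F m l x (A.act (C.hyperplane X h)).space = projWeight F (A.act C).space *
      (‖G.starProjection h‖ ^ 2 / ‖h‖ ^ 2 * (‖y‖ ^ 2 - inner ℝ h y ^ 2 / ‖h‖ ^ 2) ^ m *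
        (‖G.starProjection y‖ ^ 2 - inner ℝ (G.starProjection h) y ^ 2 /
          ‖G.starProjection h‖ ^ 2) ^ l) := by
  subst hG
  set L := (A.act C).space with hL
  set T := A.embed C with hT
  have hle : F ⊓ L ≤ LinearMap.range T.toLinearMap := by
    rw [hT, A.range_embed C]
    exact inf_le_right
  have hTL : ∀ v, T v ∈ L := A.embed_mem C
  have hinner : ∀ v : C.space, inner ℝ (T v) x = inner ℝ v y := by
    intro v
    rw [← T.inner_map_map v y, hy, ← Submodule.inner_starProjection_left_eq_right,
      Submodule.starProjection_eq_self_iff.2 (hTL v)]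
  have hproj : (F ⊓ L).starProjection x = (F ⊓ L).starProjection (T y) := by
    rw [hy]
    exact (congrArg (fun B : Eucl n →L[ℝ] Eucl n => B x)
      (Submodule.starProjection_comp_starProjection_of_le (inf_le_right : F ⊓ L ≤ L))).symm
  have e1 : F ⊓ (A.act (C.hyperplane X h)).space =
      (F ⊓ L) ⊓ (Submodule.span ℝ {T h})ᗮ := by
    rw [A.act_hyperplane_space C X hh, inf_assoc]
  rw [croftonIntegrand, projWeight_act_hyperplane F A C X hW hh,
    Submodule.starProjection_congr e1,
    Submodule.starProjection_congr (A.act_hyperplane_space C X hh),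
    norm_starProjection_inf_orthogonal_sq, norm_starProjection_inf_orthogonal_sq, ← hL, ← hT,
    Submodule.starProjection_eq_self_iff.2 (hTL h), ← hy, hproj,
    LinearIsometry.starProjection_map T hle, LinearIsometry.starProjection_map T hle, hinner, hinner,
    LinearIsometry.norm_map, LinearIsometry.norm_map, LinearIsometry.norm_map,
    LinearIsometry.norm_map]
  ring

theorem gaussMeasure_ae_notMem {V : Type*} [NormedAddCommGroup V] [InnerProductSpace ℝ V]
    [FiniteDimensional ℝ V] [MeasurableSpace V] [BorelSpace V] {K : Submodule ℝ V} (hK : K ≠ ⊤) :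
    ∀ᵐ v ∂(gaussMeasure V), v ∉ K := by
  have h : ∀ᵐ v ∂(volume : Measure V), v ∉ K := by
    rw [ae_iff]
    simpa using Measure.addHaar_submodule volume K hK
  exact (withDensity_absolutelyContinuous _ _).ae_le h

theorem finrank_inf_of_sup_eq_top {F : Submodule ℝ (Eucl n)} {j p : ℕ}
    (hF : Module.finrank ℝ F = j + 1 + p) (hd : d + 1 + p = n) {L : Grassmannian n (d + 1)}
    (h : F ⊔ L.space = ⊤) : Module.finrank ℝ ↥(F ⊓ L.space) = j + 1 := by
  have h1 := Submodule.finrank_sup_add_finrank_inf_eq F L.space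
  have h2 : Module.finrank ℝ L.space = d + 1 := L.2
  rw [h, finrank_top, hF, h2, finrank_euclideanSpace_fin] at h1
  omega

theorem ae_ne_zero_of_ne_zero (C : Grassmannian n (d + 1)) :
    ∀ᵐ h ∂(gaussMeasure C.space), h ≠ 0 := by
  have h3 : Module.finrank ℝ C.space = d + 1 := C.2
  have : Nontrivial C.space := Module.finrank_pos_iff (R := ℝ).1 (by omega)
  have h := gaussMeasure_ae_notMem (V := C.space) (K := ⊥) bot_ne_top
  simpa using h

theorem measurableSet_projWeight_ne_zero (F : Submodule ℝ (Eucl n)) :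
    MeasurableSet {L : Grassmannian n d | projWeight F L.space ≠ 0} :=
  ((measurableSet_singleton (0 : ℝ)).preimage
    (Grassmannian.continuous_projWeight F).measurable).compl

/-- Almost every `L` is in general position to `F`, that is, `F + L` is the whole space. A random
hyperplane of a subspace in general position fails to be so only if its normal vector is orthogonal
to the intersection with `F`, which is not zero. -/
theorem ae_projWeight_ne_zero (F : Submodule ℝ (Eucl n)) (p : ℕ) :
    ∀ (j d : ℕ) (hd : d + p = n), Module.finrank ℝ F = j + p →
      ∀ᵐ L ∂(Grassmannian.nu n d (by omega)), projWeight F L.space ≠ 0 := by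
  induction p with
  | zero =>
    intro j d hd _
    refine Eventually.of_forall fun L => ?_
    have h1 : Module.finrank ℝ L.space = d := L.2
    have h2 : L.space = ⊤ := Submodule.eq_top_of_finrank_eq (by
      rw [h1, finrank_euclideanSpace_fin]
      omega)
    rw [h2, projWeight_top]
    exact one_ne_zero
  | succ p ih =>
    intro j d hd hF
    have hn : d + 1 ≤ n := by omega
    set C := Grassmannian.coord n (d + 1) hn with hC
    set X := Grassmannian.coord n d (by omega) with hX
    have ih' := ih (j + 1) (d + 1) (by omega) (by omega)
    rw [Grassmannian.nu, ae_map_iff (OrthGroup.continuous_act _).measurable.aemeasurable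
      (measurableSet_projWeight_ne_zero F)] at ih'
    have hm := Grassmannian.measurable_act_hyperplane C X
    rw [Grassmannian.nu_eq_map_hyperplane (by omega) C X, ae_map_iff hm.aemeasurable
      (measurableSet_projWeight_ne_zero F)]
    refine (Measure.ae_prod_iff_ae_ae (p := fun q : OrthGroup n × C.space =>
      projWeight F (q.1.act (C.hyperplane X q.2)).space ≠ 0)
      (hm (measurableSet_projWeight_ne_zero F))).2 ?_
    filter_upwards [ih'] with A hA
    set G : Submodule ℝ C.space :=
      (F ⊓ (A.act C).space).comap (A.embed C).toLinearMap with hG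
    have hGbot : Gᗮ ≠ ⊤ := by
      intro h
      rw [Submodule.orthogonal_eq_top_iff] at h
      have hle : F ⊓ (A.act C).space ≤ LinearMap.range (A.embed C).toLinearMap := by
        rw [A.range_embed C]
        exact inf_le_right
      have h1 : F ⊓ (A.act C).space = ⊥ := by
        rw [← inf_eq_right.2 hle, ← Submodule.map_comap_eq, ← hG, h, Submodule.map_bot]
      have h2 := finrank_inf_of_sup_eq_top (j := j) (p := p) (by omega) (by omega)
        ((projWeight_ne_zero_iff _ _).1 hA)
      rw [h1, finrank_bot] at h2
      omega
    filter_upwards [ae_ne_zero_of_ne_zero C, gaussMeasure_ae_notMem hGbot] with h h0 hh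
    rw [projWeight_act_hyperplane F A C X hA h0]
    refine mul_ne_zero hA (div_ne_zero (pow_ne_zero _ ?_) (pow_ne_zero _ (norm_ne_zero_iff.2 h0)))
    rwa [norm_ne_zero_iff, Ne, Submodule.starProjection_apply_eq_zero_iff]

theorem croftonPoly_codim_zero {F : Submodule ℝ (Eucl n)} {j : ℕ} (hF : Module.finrank ℝ F = j)
    (m l : ℕ) (x : Eucl n) :
    croftonPoly n j 0 m l (‖x‖ ^ 2) (‖F.starProjection x‖ ^ 2) =
      (‖x‖ ^ 2) ^ m * (‖F.starProjection x‖ ^ 2) ^ l := by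
  rw [croftonPoly, Finset.sum_range_succ', Finset.sum_eq_zero, zero_add, croftonCoeff]
  · have h1 := (gammaRatio_pos (a := (n : ℝ) / 2 + 1) (by positivity) m).ne'
    simp only [Nat.choose_zero_right, Nat.cast_one, gammaRatio_zero, mul_one, one_mul, sub_zero,
      Nat.sub_zero, add_zero, div_self h1]
    rcases Nat.eq_zero_or_pos l with rfl | hl
    · simp
    rcases Nat.eq_zero_or_pos j with rfl | hj
    · have : F = ⊥ := Submodule.finrank_eq_zero.1 hF
      have h2 : F.starProjection x = 0 := by
        rw [Submodule.starProjection_congr this, Submodule.starProjection_bot]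
        rfl
      simp [h2, hl.ne']
    · have h2 := (gammaRatio_pos (a := (j : ℝ) / 2) (by positivity) l).ne'
      rw [div_self h2, one_mul]
  · intro i _
    rw [croftonCoeff, zero_div, gammaRatio_zero_left (Nat.succ_ne_zero i)]
    simp

/-- The leading constant of the integral formula, with `p = n - d` the codimension of `L` and
`j + p` the dimension of `F`. -/
noncomputable def croftonConst (n d j p : ℕ) : ℝ :=
  ((d.factorial : ℝ) * (j + p).factorial) / ((n.factorial : ℝ) * j.factorial)

/-- The diagonal values of the integral formula, by induction on the codimension `p` of `L`. The
random subspace `L` is generated as a random hyperplane of a random subspace of dimension `d + 1`;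
integration over the hyperplane by `integral_hyperplane` leaves a combination of integrands of the
same form, to which the induction hypothesis applies. -/
theorem integral_croftonIntegrand (F : Submodule ℝ (Eucl n)) (x : Eucl n) (p : ℕ) :
    ∀ (j d : ℕ) (hd : d + p = n), Module.finrank ℝ F = j + p → ∀ m l : ℕ,
      ∫ L : Grassmannian n d, croftonIntegrand F m l x L.space
          ∂(Grassmannian.nu n d (by omega)) =
        croftonConst n d j p * croftonPoly n j p m l (‖x‖ ^ 2) (‖F.starProjection x‖ ^ 2) := by
  induction p with
  | zero =>
    intro j d hd hF m l
    have hd' : d = n := by omega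
    subst hd'
    have h : ∀ L : Grassmannian d d, croftonIntegrand F m l x L.space =
        (‖x‖ ^ 2) ^ m * (‖F.starProjection x‖ ^ 2) ^ l := by
      intro L
      have h1 : Module.finrank ℝ L.space = d := L.2
      have h2 : L.space = ⊤ := Submodule.eq_top_of_finrank_eq (by
        rw [h1, finrank_euclideanSpace_fin])
      rw [croftonIntegrand, h2, projWeight_top, Submodule.starProjection_top,
        Submodule.starProjection_congr (inf_top_eq F), one_mul]
      rfl
    simp only [h, integral_const, probReal_univ, one_smul]
    rw [Nat.cast_zero, croftonPoly_codim_zero (j := j) hF, croftonConst, add_zero,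
      div_self (by positivity), one_mul]
  | succ p ih =>
    intro j d hd hF m l
    have hn : d + 1 ≤ n := by omega
    set C := Grassmannian.coord n (d + 1) hn with hC
    set X := Grassmannian.coord n d (by omega) with hX
    have hfC : Module.finrank ℝ C.space = d + 1 := C.2
    have hm := Grassmannian.measurable_act_hyperplane C X
    have hgood := ae_projWeight_ne_zero F p (j + 1) (d + 1) (by omega) (by omega)
    rw [Grassmannian.nu, ae_map_iff (OrthGroup.continuous_act _).measurable.aemeasurable
      (measurableSet_projWeight_ne_zero F), ← hC] at hgood
    have hint : Integrable (fun q : OrthGroup n × C.space =>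
        croftonIntegrand F m l x (q.1.act (C.hyperplane X q.2)).space)
        ((OrthGroup.haar n).prod (gaussMeasure C.space)) := by
      have h1 := integrable_croftonIntegrand (d := d) (by omega) F m l x
      rw [Grassmannian.nu_eq_map_hyperplane (by omega) C X] at h1
      exact h1.comp_measurable hm
    rw [Grassmannian.nu_eq_map_hyperplane (by omega) C X, integral_map hm.aemeasurable
      (measurable_croftonIntegrand F m l x).aestronglyMeasurable, integral_prod _ hint]
    have hinner : ∀ᵐ A ∂(OrthGroup.haar n),
        ∫ h, croftonIntegrand F m l x (A.act (C.hyperplane X h)).space ∂(gaussMeasure C.space) =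
        ∑ i ∈ Finset.range (m + 1), ((j + 1 : ℝ) / (d + 1) * croftonCoeff (d + 1) j 1 m l i) *
          croftonIntegrand F (m - i) (l + i) x (A.act C).space := by
      filter_upwards [hgood] with A hA
      set G : Submodule ℝ C.space :=
        (F ⊓ (A.act C).space).comap (A.embed C).toLinearMap with hG
      have hle : F ⊓ (A.act C).space ≤ LinearMap.range (A.embed C).toLinearMap := by
        rw [A.range_embed C]
        exact inf_le_right
      obtain ⟨y, hy⟩ : ∃ y : C.space, A.embed C y = (A.act C).space.starProjection x := by
        have : (A.act C).space.starProjection x ∈ LinearMap.range (A.embed C).toLinearMap := by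
          rw [A.range_embed C]
          exact Submodule.starProjection_apply_mem _ _
        exact this
      have hGd : Module.finrank ℝ G = j + 1 := by
        rw [← finrank_inf_of_sup_eq_top (j := j) (p := p) (by omega) (by omega)
          ((projWeight_ne_zero_iff _ _).1 hA)]
        have e : G.map (A.embed C).toLinearMap = F ⊓ (A.act C).space := by
          rw [hG, Submodule.map_comap_eq, inf_eq_right.2 hle]
        rw [← e]
        exact (G.equivMapOfInjective _ (A.embed C).injective).finrank_eq
      have hform := integral_hyperplane G (by omega) y m l
      rw [hGd, hfC] at hform
      have hae : ∀ᵐ h ∂(gaussMeasure C.space),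
          croftonIntegrand F m l x (A.act (C.hyperplane X h)).space =
          projWeight F (A.act C).space *
      (‖G.starProjection h‖ ^ 2 / ‖h‖ ^ 2 * (‖y‖ ^ 2 - inner ℝ h y ^ 2 / ‖h‖ ^ 2) ^ m *
        (‖G.starProjection y‖ ^ 2 - inner ℝ (G.starProjection h) y ^ 2 /
          ‖G.starProjection h‖ ^ 2) ^ l) := by
        filter_upwards [ae_ne_zero_of_ne_zero C] with h h0
        exact croftonIntegrand_act_hyperplane F A C X hA m l x hy h0 G hG
      rw [integral_congr_ae hae, integral_const_mul, hform, croftonPoly, Finset.mul_sum,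
        Finset.mul_sum]
      have hy1 : ‖(A.act C).space.starProjection x‖ = ‖y‖ := by rw [← hy, LinearIsometry.norm_map]
      have hy2 : ‖(F ⊓ (A.act C).space).starProjection x‖ = ‖G.starProjection y‖ := by
        rw [← (A.embed C).norm_map, ← LinearIsometry.starProjection_map _ hle, hy]
        congr 1
        exact (congrArg (fun B : Eucl n →L[ℝ] Eucl n => B x)
          (Submodule.starProjection_comp_starProjection_of_le
            (inf_le_right : F ⊓ (A.act C).space ≤ (A.act C).space))).symm
      refine Finset.sum_congr rfl fun i _ => ?_
      rw [croftonIntegrand, hy1, hy2]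
      push_cast
      rw [add_sub_cancel_right]
      ring
    rw [integral_congr_ae hinner, integral_finsetSum]
    · have hterm : ∀ i, ∫ A : OrthGroup n, croftonIntegrand F (m - i) (l + i) x (A.act C).space
            ∂(OrthGroup.haar n) = croftonConst n (d + 1) (j + 1) p *
          croftonPoly n (j + 1) p (m - i) (l + i) (‖x‖ ^ 2) (‖F.starProjection x‖ ^ 2) := by
        intro i
        have h1 := ih (j + 1) (d + 1) (by omega) (by omega) (m - i) (l + i)
        rw [Grassmannian.nu, integral_map (OrthGroup.continuous_act _).measurable.aemeasurable
          (measurable_croftonIntegrand F _ _ x).aestronglyMeasurable] at h1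
        rw [hC, h1]
        push_cast
        rfl
      simp only [integral_const_mul, hterm]
      have hnp : (n : ℝ) - p = d + 1 := by
        have : (n : ℝ) = d + (p + 1) := by exact_mod_cast hd.symm
        rw [this]
        ring
      have halg := sum_croftonCoeff_mul_croftonPoly (n := n) (j := j) (p := p) (by positivity)
        (by positivity) (by linarith [(Nat.cast_nonneg d : (0 : ℝ) ≤ d)]) m l (‖x‖ ^ 2)
        (‖F.starProjection x‖ ^ 2)
      rw [hnp] at halg
      push_cast
      rw [← halg, Finset.mul_sum]
      refine Finset.sum_congr rfl fun i _ => ?_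
      have hc : (j + 1 : ℝ) / (d + 1) * croftonConst n (d + 1) (j + 1) p =
          croftonConst n d j (p + 1) := by
        rw [croftonConst, croftonConst, Nat.factorial_succ d, Nat.factorial_succ j,
          show j + 1 + p = j + (p + 1) by ring]
        push_cast
        field_simp
      rw [← hc]
      ring
    · intro i _
      refine Integrable.const_mul ?_ _
      have h1 := integrable_croftonIntegrand (d := d + 1) hn F (m - i) (l + i) x
      rw [Grassmannian.nu] at h1
      exact h1.comp_measurable (OrthGroup.continuous_act _).measurable

end Step

/-! ### Symmetric tensors are determined by their diagonal values -/

namespace SymTensor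

variable {n p q : ℕ}

/-- Evaluation of a symmetric tensor at `(x, …, x)`, as a continuous linear functional. -/
noncomputable def diag (x : Eucl n) : SymTensor n p →L[ℝ] ℝ :=
  (ContinuousMultilinearMap.apply ℝ (fun _ : Fin p => Eucl n) ℝ fun _ => x).comp
    (symTensorSubmodule n p).subtypeL

theorem diag_apply (x : Eucl n) (T : SymTensor n p) : diag x T = T.toMap fun _ => x := rfl

theorem diag_mul (x : Eucl n) (S : SymTensor n p) (T : SymTensor n q) :
    diag x (mul S T) = diag x S * diag x T := by
  have h : diag x (mul S T) = ((p + q).factorial : ℝ)⁻¹ *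
      ∑ _σ : Equiv.Perm (Fin (p + q)), tensorMul S.toMap T.toMap fun _ => x := by
    rw [diag_apply]
    simp only [mul, toMap, smul_apply, sum_apply,
      ContinuousMultilinearMap.domDomCongr_apply, smul_eq_mul]
  rw [h, tensorMul_apply, Finset.sum_const, Finset.card_univ, Fintype.card_perm, Fintype.card_fin,
    nsmul_eq_mul, inv_mul_cancel_left₀ (by positivity)]
  rfl

theorem diag_pow (x : Eucl n) (T : SymTensor n p) (r : ℕ) :
    diag x (pow T r) = diag x T ^ r := by
  induction r with
  | zero => rfl
  | succ r ih =>
    rw [pow_succ, ← ih]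
    exact diag_mul x _ _

theorem diag_cast (x : Eucl n) (h : p = q) (T : SymTensor n p) :
    diag x (cast h T) = diag x T := by
  subst h
  rfl

theorem diag_metricTensorOf (x : Eucl n) (L : Submodule ℝ (Eucl n)) :
    diag x (metricTensorOf L) = ‖L.starProjection x‖ ^ 2 :=
  real_inner_self_eq_norm_sq (L.starProjection x)

theorem diag_metricTensor (x : Eucl n) : diag x (metricTensor n) = ‖x‖ ^ 2 :=
  real_inner_self_eq_norm_sq x

/-- Polarization: the `p`-th derivative at `0` of the homogeneous polynomial `x ↦ T(x, …, x)` is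
`p!` times the symmetric tensor `T`. -/
theorem eq_zero_of_diag_eq_zero {T : SymTensor n p} (h : ∀ x, diag x T = 0) : T = 0 := by
  refine Subtype.ext (ContinuousMultilinearMap.ext fun v => ?_)
  have h1 := T.1.iteratedFDeriv_comp_diagonal 0 v
  have h2 : (fun x : Eucl n => T.1 fun _ => x) = fun _ => 0 := funext h
  have h3 : ∀ σ : Equiv.Perm (Fin p), (T.1 fun i => v (σ i)) = T.1 v := fun σ => T.2 σ v
  rw [h2] at h1
  simp only [h3, Finset.sum_const, Finset.card_univ, Fintype.card_perm, Fintype.card_fin,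
    nsmul_eq_mul] at h1
  have h4 : iteratedFDeriv ℝ p (fun _ : Eucl n => (0 : ℝ)) 0 v = 0 := by
    rw [iteratedFDeriv_fun_zero]
    rfl
  rw [h4] at h1
  have h5 : ((p.factorial : ℕ) : ℝ) ≠ 0 := by positivity
  exact (mul_eq_zero.1 h1.symm).resolve_left h5

theorem ext_diag {S T : SymTensor n p} (h : ∀ x, diag x S = diag x T) : S = T :=
  sub_eq_zero.1 (eq_zero_of_diag_eq_zero fun x => by rw [map_sub, h, sub_self])

instance instFiniteDimensional (n p : ℕ) : FiniteDimensional ℝ (SymTensor n p) := by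
  have h : FiniteDimensional ℝ (ContinuousMultilinearMap ℝ (fun _ : Fin p => Eucl n) ℝ) :=
    Module.Finite.of_injective (ContinuousMultilinearMap.toMultilinearMapLinear :
      ContinuousMultilinearMap ℝ (fun _ : Fin p => Eucl n) ℝ →ₗ[ℝ]
        MultilinearMap ℝ (fun _ : Fin p => Eucl n) ℝ)
      ContinuousMultilinearMap.toMultilinearMap_injective
  exact inferInstanceAs (FiniteDimensional ℝ ↥(symTensorSubmodule n p))

/-- The dual form of polarization. -/
theorem span_range_diag :
    Submodule.span ℝ (Set.range fun x : Eucl n =>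
      ((diag x : SymTensor n p →L[ℝ] ℝ) : SymTensor n p →ₗ[ℝ] ℝ)) = ⊤ := by
  set W : Subspace ℝ (Module.Dual ℝ (SymTensor n p)) :=
    Submodule.span ℝ (Set.range fun x : Eucl n =>
      ((diag x : SymTensor n p →L[ℝ] ℝ) : SymTensor n p →ₗ[ℝ] ℝ)) with hW
  have h1 : W.dualCoannihilator = ⊥ := by
    rw [Submodule.eq_bot_iff]
    intro T hT
    refine eq_zero_of_diag_eq_zero fun x => ?_
    exact (Submodule.mem_dualCoannihilator T).1 hT _ (Submodule.subset_span ⟨x, rfl⟩)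
  rw [← Subspace.dualCoannihilator_dualAnnihilator_eq (W := W), h1]
  exact Submodule.dualAnnihilator_bot

/-- A tensor-valued function is integrable if its diagonal values are. -/
theorem integrable_of_diag {α : Type*} [MeasurableSpace α] {μ : Measure α}
    {f : α → SymTensor n p} (h : ∀ x, Integrable (fun a => diag x (f a)) μ) : Integrable f μ := by
  have h1 : ∀ φ : Module.Dual ℝ (SymTensor n p), Integrable (fun a => φ (f a)) μ := by
    intro φ
    have hφ : φ ∈ Submodule.span ℝ
        (Set.range fun x : Eucl n =>
          ((diag x : SymTensor n p →L[ℝ] ℝ) : SymTensor n p →ₗ[ℝ] ℝ)) := by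
      rw [span_range_diag]
      trivial
    induction hφ using Submodule.span_induction with
    | mem φ hφ =>
      obtain ⟨x, rfl⟩ := hφ
      exact h x
    | zero => exact integrable_zero _ _ _
    | add φ ψ _ _ hφ hψ => exact hφ.add hψ
    | smul c φ _ hφ => exact hφ.const_mul c
  have b := Module.finBasis ℝ (SymTensor n p)
  have h2 : f = fun a => ∑ i, b.coord i (f a) • b i := by
    funext a
    exact (b.sum_repr (f a)).symm
  rw [h2]
  exact integrable_finsetSum _ fun i _ => (h1 (b.coord i)).smul_const (b i)

end SymTensor

/-! ### The integral formula for tensors -/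

theorem mainTheorem5 (n k j m l : ℕ) (hjk : j ≤ k) (hkn : k ≤ n) (F : Grassmannian n k) :
    Integrable (fun L : Grassmannian n (n - k + j) =>
        subspaceDet F.space L.space ^ 2 •
          SymTensor.mul (SymTensor.pow (metricTensorOf L.space) m)
            (SymTensor.pow (metricTensorOf (F.space ⊓ L.space)) l))
      (Grassmannian.nu n (n - k + j) (by omega)) ∧
    ∫ L : Grassmannian n (n - k + j),
        subspaceDet F.space L.space ^ 2 •
          SymTensor.mul (SymTensor.pow (metricTensorOf L.space) m)
            (SymTensor.pow (metricTensorOf (F.space ⊓ L.space)) l)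
        ∂(Grassmannian.nu n (n - k + j) (by omega)) =
      ((((n - k + j).factorial : ℝ) * (k.factorial : ℝ)) /
            ((n.factorial : ℝ) * (j.factorial : ℝ)) *
          (Real.Gamma ((n : ℝ) / 2 + 1) / Real.Gamma ((n : ℝ) / 2 + m + 1)) *
          gammaRatio ((j : ℝ) / 2) l) •
        ∑ i : Fin (m + 1),
          ((m.choose i : ℝ) * gammaRatio ((l : ℝ) - 1) i *
              gammaRatio (((k : ℝ) - j) / 2) i *
              (Real.Gamma (((n : ℝ) - k + j) / 2 + m - (i : ℕ) + 1) /
                Real.Gamma (((n : ℝ) - k + j) / 2 + 1)) /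
              gammaRatio ((k : ℝ) / 2) (l + i)) •
            SymTensor.cast (by have := i.isLt; omega)
              (SymTensor.mul (SymTensor.pow (metricTensor n) (m - i))
                (SymTensor.pow (metricTensorOf F.space) (l + i))) := by
  set g : Grassmannian n (n - k + j) → SymTensor n (2 * m + 2 * l) := fun L =>
    subspaceDet F.space L.space ^ 2 •
          SymTensor.mul (SymTensor.pow (metricTensorOf L.space) m)
            (SymTensor.pow (metricTensorOf (F.space ⊓ L.space)) l) with hg
  have hd : n - k + j + (k - j) = n := by omega
  have hF : Module.finrank ℝ F.space = j + (k - j) := by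
    have : Module.finrank ℝ F.space = k := F.2
    omega
  have hae : ∀ x, (fun L => SymTensor.diag x (g L)) =ᵐ[Grassmannian.nu n (n - k + j) (by omega)]
      fun L => croftonIntegrand F.space m l x L.space := by
    intro x
    filter_upwards [ae_projWeight_ne_zero F.space (k - j) j (n - k + j) hd hF] with L hL
    rw [hg, map_smul, SymTensor.diag_mul, SymTensor.diag_pow, SymTensor.diag_pow,
      SymTensor.diag_metricTensorOf, SymTensor.diag_metricTensorOf,
      subspaceDet_sq ((projWeight_ne_zero_iff _ _).1 hL)]
    rfl
  have hint : Integrable g (Grassmannian.nu n (n - k + j) (by omega)) :=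
    SymTensor.integrable_of_diag fun x =>
      (integrable_croftonIntegrand _ F.space m l x).congr (hae x).symm
  refine ⟨hint, SymTensor.ext_diag fun x => ?_⟩
  rw [← ContinuousLinearMap.integral_comp_comm _ hint, integral_congr_ae (hae x),
    integral_croftonIntegrand F.space x (k - j) j (n - k + j) hd hF, map_smul, map_sum,
    croftonPoly, croftonConst, Finset.sum_range, smul_eq_mul, Finset.mul_sum, Finset.mul_sum]
  refine Finset.sum_congr rfl fun i _ => ?_
  have hi : (i : ℕ) ≤ m := Nat.lt_succ_iff.1 i.2
  rw [map_smul, SymTensor.diag_cast, SymTensor.diag_mul, SymTensor.diag_pow, SymTensor.diag_pow,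
    SymTensor.diag_metricTensor, SymTensor.diag_metricTensorOf, smul_eq_mul, croftonCoeff,
    Nat.add_sub_cancel' hjk, Nat.cast_sub hjk]
  have hb : (0 : ℝ) < ((n : ℝ) - k + j) / 2 + 1 := by
    have h1 : (k : ℝ) ≤ n := by exact_mod_cast hkn
    have h2 : (0 : ℝ) ≤ j := by positivity
    linarith
  have e1 : Real.Gamma ((n : ℝ) / 2 + 1) / Real.Gamma ((n : ℝ) / 2 + m + 1) =
      (gammaRatio ((n : ℝ) / 2 + 1) m)⁻¹ := by
    rw [← gammaRatio_inv_eq (by positivity), add_right_comm]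
  have e2 : Real.Gamma (((n : ℝ) - k + j) / 2 + m - (i : ℕ) + 1) /
      Real.Gamma (((n : ℝ) - k + j) / 2 + 1) =
      gammaRatio (((n : ℝ) - k + j) / 2 + 1) (m - i) := by
    rw [← inv_inv (gammaRatio _ _), ← gammaRatio_inv_eq hb, inv_div, Nat.cast_sub hi]
    ring_nf
  rw [e1, e2, show ((n : ℝ) - (k - j)) = n - k + j by ring, add_sub_cancel (j : ℝ) k]
  ring
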